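/- Let $\mathcal G=(V,E,W)$ be a finite connected simple weighted graph, with symmetric weights $W_{ij}=W_{ji}\ge 0$, where $W_{ii}=0$ and $W_{ij}>0$ exactly when $\{i,j\}\in E$. For $\beta\in\mathbb R^V$ let $H_\beta$ be the $V\times V$ matrix with diagonal entries $2\beta_i$ and off-diagonal entries $-W_{ij}$. Let $\beta=(\beta_i)_{i\in V}$ be a random vector (the potential of the $H^{2|2}$-model) with law $$d\nu^W(\beta)=\Big(\sqrt{\tfrac2\pi}\Big)^{|V|}\mathbf 1_{\{H_\beta>0\}}\,e^{-\frac12\langle 1,H_\beta 1\rangle}\frac{1}{\sqrt{\det H_\beta}}\prod_{i\in V}d\beta_i ,$$ and put $H=H_\beta$, $G=H^{-1}$. Let $U\subset V$ be nonempty and indistinguishable from outside, i.e. $W_{ki}=W_{kj}$ for all $i,j\in U$ and $k\notin U$. Let $i_0\in V\setminus U$, and define the $u$-field pinned at $i_0$ by $$e^{u_k}=\frac{G(k,i_0)}{G(i_0,i_0)},\qquad k\in V,$$ and $\gamma=\frac{1}{2G(i_0,i_0)}$. The reduced graph $\mathcal G'$ has vertex set $V'=(V\setminus U)\cup\{u\}$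 and weights $W'_{k\ell}=W_{k\ell}$ for $k,\ell\neq u$, $W'_{ku}=W'_{uk}=\sum_{i\in U}W_{ki}$ for $k\neq u$, and $W'_{uu}=0$. The reduced potential is $\beta'_k=\beta_k$ for $k\neq u$ and $$\frac1{2\beta'_u}=\frac1{|U|^2}\sum_{i,j\in U}\big((H_{U,U})^{-1}\big)(i,j),$$ where $H_{U,U}$ is the submatrix of $H$ on $U\times U$. Let $H'$ be the matrix on $V'$ with diagonal entries $2\beta'_k$ and off-diagonal entries $-W'_{k\ell}$, let $G'=(H')^{-1}$, and let $e^{u'_k}=G'(k,i_0)/G'(i_0,i_0)$ for $k\in V'$. Let $\mathcal F'$ be the $\sigma$-algebra generated by $(\beta'_k)_{k\in V'\setminus\{i_0\}}$ and $\gamma$. Then $\gamma$ has the Gamma distribution with shape $\frac12$ and rate $1$, every $e^{u_k}$ ($k\in V$) is integrable, and almost surely $$\forall k\in V\setminus U,\quad \mathbb E\big[e^{u_k}\mid\mathcal F'\big]=e^{u'_k}\qquad\text{and}\qquad \forall k\in U,\quad \mathbb E\big[e^{u_k}\mid\mathcal F'\big]=e^{u'_u}.$$ -/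

import Mathlib

open MeasureTheory ProbabilityTheory

noncomputable section

namespace H22

/-- A finite weighted graph on the vertex set `V`, given by its edge weights: symmetric,
nonnegative, zero on the diagonal; `W i j = 0` means that `i` and `j` are not neighbours. -/
structure WeightedGraph (V : Type*) where
  weight : Matrix V V ℝ
  symm : ∀ i j, weight i j = weight j i
  nonneg : ∀ i j, 0 ≤ weight i j
  diag : ∀ i, weight i i = 0

namespace WeightedGraph

variable {V : Type*} (𝒢 : WeightedGraph V)

/-- The underlying simple graph: the edges are the pairs of positive weight. -/
def toSimpleGraph : SimpleGraph V where
  Adj i j := 0 < 𝒢.weight i j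
  symm := ⟨fun i j h => by rw [𝒢.symm j i]; exact h⟩
  loopless := ⟨fun i h => by rw [𝒢.diag i] at h; exact lt_irrefl _ h⟩

/-- `U` is indistinguishable from outside: every vertex outside `U` is joined to all the vertices
of `U` with the same weight. -/
def Indistinguishable (U : Finset V) : Prop :=
  ∀ i ∈ U, ∀ j ∈ U, ∀ k ∉ U, 𝒢.weight k i = 𝒢.weight k j

variable [Fintype V] [DecidableEq V]

/-- The Schrödinger operator `H_β`, with diagonal entries `2 β i` and off-diagonal entries
`- W i j`. -/
def schrodinger (β : V → ℝ) : Matrix V V ℝ :=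
  Matrix.diagonal (fun i => 2 * β i) - 𝒢.weight

/-- The Green matrix `G = H_β⁻¹`. -/
def green (β : V → ℝ) : Matrix V V ℝ := (𝒢.schrodinger β)⁻¹

open Classical in
/-- The density
`(2/π)^(|V|/2) 1_{H_β > 0} exp(-⟨1, H_β 1⟩ / 2) / √(det H_β)` of the random potential. -/
def potentialDensity (β : V → ℝ) : ℝ :=
  if (𝒢.schrodinger β).PosDef then
    Real.sqrt (2 / Real.pi) ^ Fintype.card V
      * Real.exp (-(1 / 2) * ((fun _ => 1) ⬝ᵥ ((𝒢.schrodinger β).mulVec (fun _ => 1))))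
      / Real.sqrt (𝒢.schrodinger β).det
  else 0

/-- The law `ν^W` of the random potential of the `H^{2|2}`-model. -/
def potentialLaw : Measure (V → ℝ) :=
  volume.withDensity fun β => ENNReal.ofReal (𝒢.potentialDensity β)

/-- The `u`-field pinned at `i₀`, that is, `exp (u k) = G(k, i₀) / G(i₀, i₀)`. -/
def uField (β : V → ℝ) (i₀ : V) (k : V) : ℝ :=
  Real.log (𝒢.green β k i₀ / 𝒢.green β i₀ i₀)

/-- The variable `γ = 1 / (2 G(i₀, i₀))`. -/
def pinGamma (β : V → ℝ) (i₀ : V) : ℝ := 1 / (2 * 𝒢.green β i₀ i₀)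

end WeightedGraph

/-- The vertex set `(V \ U) ∪ {u}` of the reduced graph; the vertex `u` is `none`. -/
abbrev ReducedVertex {V : Type*} (U : Finset V) : Type _ := Option {k : V // k ∉ U}

namespace WeightedGraph

variable {V : Type*} (𝒢 : WeightedGraph V) (U : Finset V)

/-- The edge weights of the reduced graph. -/
def reducedWeight : ReducedVertex U → ReducedVertex U → ℝ
  | some k, some l => 𝒢.weight k l
  | some k, none => ∑ i ∈ U, 𝒢.weight k i
  | none, some k => ∑ i ∈ U, 𝒢.weight k i
  | none, none => 0

/-- The reduced graph, in which `U` is replaced by a single vertex. -/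
def reduced : WeightedGraph (ReducedVertex U) where
  weight := 𝒢.reducedWeight U
  symm := by
    rintro (_ | k) (_ | l)
    · rfl
    · rfl
    · rfl
    · exact 𝒢.symm k l
  nonneg := by
    rintro (_ | k) (_ | l)
    · exact le_refl _
    · exact Finset.sum_nonneg fun i _ => 𝒢.nonneg l i
    · exact Finset.sum_nonneg fun i _ => 𝒢.nonneg k i
    · exact 𝒢.nonneg k l
  diag := by
    rintro (_ | k)
    · rfl
    · exact 𝒢.diag k

variable [Fintype V] [DecidableEq V]

/-- The matrix `Ĝ^U = (H_{U,U})⁻¹`. -/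
def greenOn (β : V → ℝ) : Matrix U U ℝ :=
  ((𝒢.schrodinger β).submatrix (fun i : U => (i : V)) (fun i : U => (i : V)))⁻¹

/-- The coarse-grained potential `β'`: it agrees with `β` outside `U`, and
`1 / (2 β'_u) = |U|⁻² ∑_{i, j ∈ U} Ĝ^U(i, j)`. -/
def reducedPotential (β : V → ℝ) : ReducedVertex U → ℝ
  | some k => β k
  | none => 1 / (2 * (1 / (U.card : ℝ) ^ 2 * ∑ i : U, ∑ j : U, 𝒢.greenOn U β i j))

/-- The `σ`-algebra generated by the random variables `β'_k`, for `k` a vertex of the reduced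
graph other than the pinning vertex `i₀`, and by `γ`. -/
@[reducible] def reducedSigma {Ω : Type*} (β : Ω → V → ℝ) (i₀ : {k : V // k ∉ U}) : MeasurableSpace Ω :=
  (⨆ k : {k : ReducedVertex U // k ≠ some i₀},
      MeasurableSpace.comap (fun ω => 𝒢.reducedPotential U (β ω) k) inferInstance)
    ⊔ MeasurableSpace.comap (fun ω => 𝒢.pinGamma (β ω) i₀) inferInstance

end WeightedGraph

end H22

end

/-! Restricted to `U`, the column `G(·, i₀)` solves an equation for `H_{U,U}` whose right-hand side
is constant on `U`, because `U` is indistinguishable. Hence on `U` it is a multiple of the row sums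
`R_k = ((H_{U,U})⁻¹ 1)(k)`. Lifting vectors from the reduced graph with this profile intertwines
`H'` and `H` (`schrodinger_mulVec_liftVec`). So `G'` and `G` agree outside `U`, and `G'(u, i₀)` is
the average of `G(k, i₀)` over `k ∈ U`. Thus `e^{u'}` equals `e^u` outside `U`, and at `u` it is the
average of `e^{u_k}` over `U`. It is `𝓕'`-measurable up to null sets, since the ratio `G'(·, i₀) /
G'(i₀, i₀)` solves a Dirichlet problem that does not involve `β'` at `i₀` (`pinnedColumn_update`).

It remains to see that the `e^{u_k}`, `k ∈ U`, have the same integral over each set of `𝓕'`. Each is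
`R_k` times a common function of `β'`, and both `β'` and the Schur complement of `H_{U,U}` see the
potential on `U` only through `M = ∑ R_k`. So it suffices that, under the potential law of the graph
induced on `U`, `E[R_k Ψ(M)]` does not depend on `k` (`lintegral_greenRow_eq`).

This comes from the Laplace transform `E exp(-⟨η, Gη⟩ / 2) = exp(-∑ η_k)` for `η ≥ 0`
(`lintegral_exp_green_quadratic`). Its derivative in `η_k` at `η = t·1` gives `E[R_k exp(-t² M / 2)]
= t⁻¹ exp(-|U| t)`, free of `k`, and a Laplace transform determines a measure. The transform itself
is obtained by removing vertices one at a time: in the disintegration along the potential off `i`,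
the variable `γ` is Gamma with shape 1/2 and independent of the rest
(`lintegral_potentialLaw_vertex`). The same disintegration yields the law of `γ` and the
integrability of `e^{u_k}`. -/

noncomputable section

open Matrix

namespace H22.WeightedGraph

/-! ### Schrödinger operators: maximum principle and positivity of the Green matrix. -/

/-- The pullback of a weighted graph along a map. -/
def comap {V A : Type*} (𝒢 : WeightedGraph V) (f : A → V) : WeightedGraph A where
  weight := 𝒢.weight.submatrix f f
  symm _ _ := 𝒢.symm _ _
  nonneg _ _ := 𝒢.nonneg _ _
  diag _ := 𝒢.diag _

variable {V : Type*} [Fintype V] [DecidableEq V] (𝒢 : WeightedGraph V)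

omit [Fintype V] in
lemma schrodinger_isHermitian (β : V → ℝ) : (𝒢.schrodinger β).IsHermitian := by
  ext i j
  by_cases h : i = j
  · subst h; simp
  · simp [schrodinger, diagonal_apply_ne _ h, diagonal_apply_ne _ (Ne.symm h), 𝒢.symm i j]

omit [Fintype V] in
lemma schrodinger_transpose (β : V → ℝ) : (𝒢.schrodinger β)ᵀ = 𝒢.schrodinger β := by
  exact 𝒢.schrodinger_isHermitian β

lemma schrodinger_mulVec_apply (β x : V → ℝ) (k : V) :
    (𝒢.schrodinger β *ᵥ x) k = 2 * β k * x k - ∑ l, 𝒢.weight k l * x l := by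
  simp only [schrodinger, sub_mulVec, Pi.sub_apply, mulVec_diagonal]
  rfl

omit [Fintype V] in
lemma schrodinger_comap {A : Type*} [Fintype A] [DecidableEq A] {f : A → V}
    (hf : Function.Injective f) (β : V → ℝ) :
    (𝒢.comap f).schrodinger (fun a => β (f a)) = (𝒢.schrodinger β).submatrix f f := by
  ext i j
  simp [schrodinger, comap, diagonal_apply, hf.eq_iff]

variable {𝒢} in
lemma isUnit_det {β : V → ℝ} (h : (𝒢.schrodinger β).PosDef) :
    IsUnit (𝒢.schrodinger β).det :=
  (isUnit_iff_isUnit_det _).1 h.isUnit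

variable {𝒢} in
lemma schrodinger_mulVec_green {β : V → ℝ} (h : (𝒢.schrodinger β).PosDef) (x : V → ℝ) :
    𝒢.schrodinger β *ᵥ (𝒢.green β *ᵥ x) = x := by
  rw [green, mulVec_mulVec, mul_nonsing_inv _ (isUnit_det h), one_mulVec]

variable {𝒢} in
lemma green_mulVec_eq {β : V → ℝ} (h : (𝒢.schrodinger β).PosDef) {x y : V → ℝ}
    (hxy : 𝒢.schrodinger β *ᵥ x = y) : 𝒢.green β *ᵥ y = x := by
  rw [green, ← hxy, mulVec_mulVec, nonsing_inv_mul _ (isUnit_det h), one_mulVec]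

lemma green_transpose (β : V → ℝ) : (𝒢.green β)ᵀ = 𝒢.green β := by
  rw [green, transpose_nonsing_inv, schrodinger_transpose]

lemma green_quadratic_comm (β x y : V → ℝ) :
    x ⬝ᵥ (𝒢.green β *ᵥ y) = y ⬝ᵥ (𝒢.green β *ᵥ x) := by
  rw [dotProduct_mulVec, ← mulVec_transpose, green_transpose, dotProduct_comm]

variable {𝒢} in
/-- Maximum principle: a supersolution of a positive definite Schrödinger operator is
nonnegative. -/
lemma nonneg_of_schrodinger_mulVec_nonneg {β : V → ℝ} (h : (𝒢.schrodinger β).PosDef)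
    {x : V → ℝ} (hx : ∀ k, 0 ≤ (𝒢.schrodinger β *ᵥ x) k) (k : V) : 0 ≤ x k := by
  by_contra hk
  push Not at hk
  -- Test against the negative part `m` of `x`. Since `m ≥ -x`, with equality wherever `m > 0`, and
  -- the off-diagonal entries of `H` are nonpositive, `⟨m, Hm⟩ ≤ -⟨m, Hx⟩ ≤ 0`, which contradicts
  -- definiteness.
  set m : V → ℝ := fun k => max (-x k) 0 with hm
  have hm0 : m ≠ 0 := fun h0 => by
    have := congrFun h0 k
    simp only [hm, Pi.zero_apply] at this
    have := le_max_left (-x k) 0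
    linarith
  have hpos := h.dotProduct_mulVec_pos hm0
  have hle : m ⬝ᵥ (𝒢.schrodinger β *ᵥ m) ≤ -(m ⬝ᵥ (𝒢.schrodinger β *ᵥ x)) := by
    rw [← dotProduct_neg, ← mulVec_neg]
    refine Finset.sum_le_sum fun j _ => ?_
    rw [schrodinger_mulVec_apply, schrodinger_mulVec_apply]
    have hmj : 0 ≤ m j := le_max_right _ _
    have h1 : m j * m j = m j * -x j := by
      simp only [hm]
      rcases le_total (-x j) 0 with h2 | h2
      · rw [max_eq_right h2]; simp
      · rw [max_eq_left h2]
    have h2 : ∑ l, 𝒢.weight j l * (-x) l ≤ ∑ l, 𝒢.weight j l * m l :=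
      Finset.sum_le_sum fun l _ => mul_le_mul_of_nonneg_left (le_max_left _ _) (𝒢.nonneg _ _)
    have h3 := mul_le_mul_of_nonneg_left h2 hmj
    have h4 : (-x) j = - x j := rfl
    rw [h4]
    calc m j * (2 * β j * m j - ∑ l, 𝒢.weight j l * m l)
        = 2 * β j * (m j * m j) - m j * ∑ l, 𝒢.weight j l * m l := by ring
      _ ≤ 2 * β j * (m j * -x j) - m j * ∑ l, 𝒢.weight j l * (-x) l := by rw [h1]; linarith
      _ = _ := by ring
  have hnn : 0 ≤ m ⬝ᵥ (𝒢.schrodinger β *ᵥ x) :=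
    Finset.sum_nonneg fun j _ => mul_nonneg (le_max_right _ _) (hx j)
  simp only [star_trivial] at hpos
  linarith

variable {𝒢} in
lemma green_mulVec_nonneg {β : V → ℝ} (h : (𝒢.schrodinger β).PosDef) {η : V → ℝ}
    (hη : ∀ k, 0 ≤ η k) (k : V) : 0 ≤ (𝒢.green β *ᵥ η) k :=
  nonneg_of_schrodinger_mulVec_nonneg h (fun k => by rw [schrodinger_mulVec_green h]; exact hη k) k

variable {𝒢} in
lemma green_nonneg {β : V → ℝ} (h : (𝒢.schrodinger β).PosDef) (i j : V) :
    0 ≤ 𝒢.green β i j := by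
  have := green_mulVec_nonneg h (η := Pi.single j 1)
    (fun k => by by_cases hk : k = j <;> simp [hk]) i
  simpa using this

variable {𝒢} in
lemma green_diag_pos {β : V → ℝ} (h : (𝒢.schrodinger β).PosDef) (i : V) :
    0 < 𝒢.green β i i := h.inv.diag_pos

variable {𝒢} in
lemma schrodinger_mulVec_green_col {β : V → ℝ} (h : (𝒢.schrodinger β).PosDef) (i : V) :
    𝒢.schrodinger β *ᵥ (fun k => 𝒢.green β k i) = Pi.single i 1 := by
  have := schrodinger_mulVec_green h (Pi.single i 1)
  rwa [mulVec_single_one] at this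

variable {𝒢} in
-- Zeros of a nonnegative column propagate to neighbours: at a zero `a` the equation reads `-∑ W(a,
-- l) G(l, i) ≥ 0`, so every term vanishes. By connectedness they would reach the diagonal entry,
-- which is positive.
lemma green_pos (hconn : 𝒢.toSimpleGraph.Connected) {β : V → ℝ}
    (h : (𝒢.schrodinger β).PosDef) (k i : V) : 0 < 𝒢.green β k i := by
  by_contra hk
  have hz : 𝒢.green β k i = 0 := le_antisymm (not_lt.1 hk) (green_nonneg h _ _)
  have hstep : ∀ a b, 𝒢.toSimpleGraph.Adj a b → 𝒢.green β a i = 0 → 𝒢.green β b i = 0 := by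
    intro a b hab ha
    have h1 := congrFun (schrodinger_mulVec_green_col h i) a
    rw [schrodinger_mulVec_apply, ha] at h1
    have h2 : (0 : ℝ) ≤ (Pi.single i (1 : ℝ) : V → ℝ) a := by
      by_cases hk : a = i <;> simp [hk]
    have h3 : 𝒢.weight a b * 𝒢.green β b i ≤ ∑ l, 𝒢.weight a l * 𝒢.green β l i :=
      Finset.single_le_sum (f := fun l => 𝒢.weight a l * 𝒢.green β l i)
        (fun l _ => mul_nonneg (𝒢.nonneg _ _) (green_nonneg h _ _)) (Finset.mem_univ b)
    have hab' : 0 < 𝒢.weight a b := hab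
    have h5 := green_nonneg h b i
    by_contra h6
    have h7 : 0 < 𝒢.weight a b * 𝒢.green β b i := mul_pos hab' (lt_of_le_of_ne h5 (Ne.symm h6))
    linarith
  have hall : ∀ a b, 𝒢.toSimpleGraph.Reachable a b → 𝒢.green β a i = 0 → 𝒢.green β b i = 0 := by
    rintro a b ⟨p⟩
    induction p with
    | nil => exact id
    | cons hadj _ ih => exact fun ha => ih (hstep _ _ hadj ha)
  exact (green_diag_pos h i).ne' (hall k i (hconn.preconnected k i) hz)

/-! ### Block decomposition -/

section Block

variable (U : Finset V)

/-- The block of `H_β` with rows in `U` and columns outside `U`. -/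
def offBlock : Matrix U {x // x ∉ U} ℝ := fun i k => -𝒢.weight i k

/-- The Schur complement of the block `H_{U,U}`. -/
def schur (a : U → ℝ) (b : {x // x ∉ U} → ℝ) : Matrix {x // x ∉ U} {x // x ∉ U} ℝ :=
  (𝒢.comap (Subtype.val : {x // x ∉ U} → V)).schrodinger b
    - (𝒢.offBlock U)ᴴ * (𝒢.comap (Subtype.val : U → V)).green a * 𝒢.offBlock U

lemma schrodinger_submatrix_sumCompl (β : V → ℝ) :
    (𝒢.schrodinger β).submatrix (Equiv.sumCompl (· ∈ U)) (Equiv.sumCompl (· ∈ U)) =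
      fromBlocks ((𝒢.comap (Subtype.val : U → V)).schrodinger (fun x => β x)) (𝒢.offBlock U)
        (𝒢.offBlock U)ᴴ
        ((𝒢.comap (Subtype.val : {x // x ∉ U} → V)).schrodinger (fun x => β x)) := by
  rw [schrodinger_comap _ Subtype.val_injective, schrodinger_comap _ Subtype.val_injective]
  ext (i | i) (j | j)
  · rfl
  · have : (i : V) ≠ j := fun h => j.2 (h ▸ i.2)
    simp [offBlock, schrodinger, this]
  · have : (i : V) ≠ j := fun h => i.2 (h ▸ j.2)
    simp [offBlock, schrodinger, this, 𝒢.symm i j]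
  · rfl

lemma det_schrodinger_eq {β : V → ℝ}
    (h : ((𝒢.comap (Subtype.val : U → V)).schrodinger (fun x => β x)).PosDef) :
    (𝒢.schrodinger β).det =
      ((𝒢.comap (Subtype.val : U → V)).schrodinger (fun x => β x)).det *
        (𝒢.schur U (fun x => β x) (fun x => β x)).det := by
  rw [← det_submatrix_equiv_self (Equiv.sumCompl (· ∈ U)), schrodinger_submatrix_sumCompl]
  let _ := h.isUnit.invertible
  rw [det_fromBlocks₁₁, schur, green, invOf_eq_nonsing_inv]

omit [Fintype V] in
lemma posDef_comap {A : Type*} [Fintype A] [DecidableEq A] {f : A → V}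
    (hf : Function.Injective f) {β : V → ℝ} (h : (𝒢.schrodinger β).PosDef) :
    ((𝒢.comap f).schrodinger (fun x => β (f x))).PosDef := by
  rw [schrodinger_comap _ hf]
  exact h.submatrix hf

/-- The Schur criterion is applied to semidefiniteness; the factorisation of the determinant then
upgrades it to definiteness. -/
lemma posDef_schrodinger_iff (β : V → ℝ) :
    (𝒢.schrodinger β).PosDef ↔
      ((𝒢.comap (Subtype.val : U → V)).schrodinger (fun x => β x)).PosDef ∧
        (𝒢.schur U (fun x => β x) (fun x => β x)).PosDef := by
  have key : ((𝒢.comap (Subtype.val : U → V)).schrodinger (fun x => β x)).PosDef →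
      ((𝒢.schrodinger β).PosSemidef ↔ (𝒢.schur U (fun x => β x) (fun x => β x)).PosSemidef) := by
    intro h
    let _ := h.isUnit.invertible
    rw [← posSemidef_submatrix_equiv (Equiv.sumCompl (· ∈ U)), schrodinger_submatrix_sumCompl,
      PosDef.fromBlocks₁₁ _ _ h]
    rfl
  constructor
  · intro h
    have hU := 𝒢.posDef_comap (f := (Subtype.val : U → V)) Subtype.val_injective h
    refine ⟨hU, ?_⟩
    rw [((key hU).1 h.posSemidef).posDef_iff_det_ne_zero]
    have := h.det_pos.ne'
    rw [det_schrodinger_eq _ U hU] at this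
    exact right_ne_zero_of_mul this
  · rintro ⟨hU, hS⟩
    rw [((key hU).2 hS.posSemidef).posDef_iff_det_ne_zero, det_schrodinger_eq _ U hU]
    exact mul_ne_zero hU.det_pos.ne' hS.det_pos.ne'

lemma sum_split (f : V → ℝ) : ∑ x, f x = ∑ x : U, f x + ∑ x : {x // x ∉ U}, f x := by
  rw [← (Equiv.sumCompl (· ∈ U)).sum_comp, Fintype.sum_sum_type]
  rfl

end Block

end H22.WeightedGraph
end

/-! ### Measurability, and disintegration of the potential law along a vertex set. -/

noncomputable section

open Matrix

namespace H22

section Measurability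

variable {α n : Type*} [MeasurableSpace α] [Fintype n] [DecidableEq n] {M : α → Matrix n n ℝ}

lemma measurable_det_of_entries (hM : ∀ i j, Measurable fun x => M x i j) :
    Measurable fun x => (M x).det := by
  simp only [det_apply']
  exact Finset.measurable_sum _ fun σ _ =>
    (Finset.measurable_prod _ fun i _ => hM _ _).const_mul _

lemma measurable_inv_apply (hM : ∀ i j, Measurable fun x => M x i j) (i j : n) :
    Measurable fun x => (M x)⁻¹ i j := by
  simp only [inv_def, Ring.inverse_eq_inv', Matrix.smul_apply, smul_eq_mul, adjugate_apply]
  refine (measurable_det_of_entries hM).inv.mul (measurable_det_of_entries fun k l => ?_)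
  by_cases hk : k = j
  · subst hk; simp
  · simpa [updateRow_ne hk] using hM k l

omit [DecidableEq n] in
lemma isClosed_posSemidef : IsClosed {A : n → n → ℝ | (Matrix.of A).PosSemidef} := by
  simp only [posSemidef_iff_dotProduct_mulVec, Set.ofPred_and, Set.ofPred_forall]
  refine IsClosed.inter ?_ (isClosed_iInter fun x => ?_)
  · simp only [IsHermitian, ← Matrix.ext_iff, Set.ofPred_forall]
    refine isClosed_iInter fun i => isClosed_iInter fun j => isClosed_eq ?_ ?_
    · simp only [conjTranspose_apply, of_apply, star_trivial]; fun_prop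
    · simp only [of_apply]; fun_prop
  · refine isClosed_le continuous_const ?_
    simp only [dotProduct, mulVec, of_apply]
    fun_prop

/-- Definiteness is the closed condition of semidefiniteness together with a nonzero determinant. -/
lemma measurableSet_posDef (hM : ∀ i j, Measurable fun x => M x i j) :
    MeasurableSet {x | (M x).PosDef} := by
  have h : {x | (M x).PosDef} =
      (fun x => (M x : n → n → ℝ)) ⁻¹' {A | (Matrix.of A).PosSemidef} ∩
        {x | (M x).det ≠ 0} := by
    ext x
    constructor
    · exact fun h => ⟨h.posSemidef, h.det_pos.ne'⟩
    · exact fun h => (PosSemidef.posDef_iff_det_ne_zero h.1).2 h.2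
  rw [h]
  refine MeasurableSet.inter (isClosed_posSemidef.measurableSet.preimage ?_)
    ((measurable_det_of_entries hM) (measurableSet_singleton 0).compl)
  exact measurable_pi_lambda _ fun i => measurable_pi_lambda _ fun j => hM i j

omit [DecidableEq n] in
lemma measurable_mulVec_apply {m : Type*} {N : α → Matrix m n ℝ} {v : α → n → ℝ}
    (hN : ∀ i j, Measurable fun x => N x i j) (hv : ∀ j, Measurable fun x => v x j) (i : m) :
    Measurable fun x => (N x *ᵥ v x) i := by
  simp only [mulVec, dotProduct]
  exact Finset.measurable_sum _ fun j _ => (hN i j).mul (hv j)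

end Measurability

namespace WeightedGraph

variable {V : Type*} [Fintype V] [DecidableEq V] (𝒢 : WeightedGraph V)

omit [Fintype V] in
lemma measurable_schrodinger_apply {α : Type*} [MeasurableSpace α] {β : α → V → ℝ}
    (hβ : Measurable β) (i j : V) :
    Measurable fun x => 𝒢.schrodinger (β x) i j := by
  have h : ∀ k, Measurable fun x => β x k := fun k => (measurable_pi_apply k).comp hβ
  by_cases hij : i = j
  · subst hij
    simp only [schrodinger, Matrix.sub_apply, diagonal_apply_eq]
    exact ((h i).const_mul 2).sub_const _
  · simp only [schrodinger, Matrix.sub_apply, diagonal_apply_ne _ hij]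
    exact measurable_const

lemma measurable_green_apply {α : Type*} [MeasurableSpace α] {β : α → V → ℝ}
    (hβ : Measurable β) (i j : V) : Measurable fun x => 𝒢.green (β x) i j :=
  measurable_inv_apply (𝒢.measurable_schrodinger_apply hβ) i j

lemma measurable_green_mulVec {α : Type*} [MeasurableSpace α] {β : α → V → ℝ}
    (hβ : Measurable β) (η : V → ℝ) (i : V) :
    Measurable fun x => (𝒢.green (β x) *ᵥ η) i :=
  measurable_mulVec_apply (v := fun _ => η) (𝒢.measurable_green_apply hβ)
    (fun _ => measurable_const) i

lemma measurable_green_quadratic {α : Type*} [MeasurableSpace α] {β : α → V → ℝ}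
    (hβ : Measurable β) (ζ η : V → ℝ) :
    Measurable fun x => ζ ⬝ᵥ (𝒢.green (β x) *ᵥ η) := by
  simp only [dotProduct]
  exact Finset.measurable_sum _ fun j _ => (𝒢.measurable_green_mulVec hβ η j).const_mul _

lemma measurableSet_schrodinger_posDef {α : Type*} [MeasurableSpace α] {β : α → V → ℝ}
    (hβ : Measurable β) : MeasurableSet {x | (𝒢.schrodinger (β x)).PosDef} :=
  measurableSet_posDef (𝒢.measurable_schrodinger_apply hβ)

lemma measurable_potentialDensity : Measurable 𝒢.potentialDensity := by
  refine Measurable.ite (𝒢.measurableSet_schrodinger_posDef measurable_id) ?_ measurable_const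
  refine Measurable.div (Measurable.const_mul (Real.measurable_exp.comp (Measurable.const_mul ?_ _))
    _) (measurable_det_of_entries (𝒢.measurable_schrodinger_apply measurable_id)).sqrt
  simp only [dotProduct]
  exact Finset.measurable_sum _ fun j _ =>
    (measurable_mulVec_apply (𝒢.measurable_schrodinger_apply measurable_id)
      (fun _ => measurable_const) j).const_mul _

lemma potentialDensity_nonneg (β : V → ℝ) : 0 ≤ 𝒢.potentialDensity β := by
  unfold potentialDensity
  split_ifs <;> positivity

lemma ae_posDef : ∀ᵐ β ∂𝒢.potentialLaw, (𝒢.schrodinger β).PosDef := by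
  rw [potentialLaw, ae_withDensity_iff 𝒢.measurable_potentialDensity.ennreal_ofReal]
  refine Filter.Eventually.of_forall fun β h => ?_
  by_contra hβ
  exact h (by simp [potentialDensity, hβ])

lemma lintegral_potentialLaw (F : (V → ℝ) → ENNReal) :
    ∫⁻ β, F β ∂𝒢.potentialLaw = ∫⁻ β, ENNReal.ofReal (𝒢.potentialDensity β) * F β :=
  lintegral_withDensity_eq_lintegral_mul_non_measurable _
    𝒢.measurable_potentialDensity.ennreal_ofReal
    (Filter.Eventually.of_forall fun _ => ENNReal.ofReal_lt_top) F

lemma schrodinger_quadratic_one (β : V → ℝ) :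
    (fun _ => 1) ⬝ᵥ (𝒢.schrodinger β *ᵥ (fun _ => 1)) =
      ∑ k, 2 * β k - ∑ k, ∑ l, 𝒢.weight k l := by
  simp [dotProduct, schrodinger_mulVec_apply]

section Block

variable (U : Finset V)

/-- The family on `V` with given restrictions to `U` and to its complement. -/
def glue (U : Finset V) (a : U → ℝ) (b : {x // x ∉ U} → ℝ) : V → ℝ :=
  fun x => if h : x ∈ U then a ⟨x, h⟩ else b ⟨x, h⟩

omit [Fintype V] in
@[simp] lemma glue_mem (a : U → ℝ) (b : {x // x ∉ U} → ℝ) (x : U) : glue U a b x = a x := by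
  simp [glue]

omit [Fintype V] in
@[simp] lemma glue_notMem (a : U → ℝ) (b : {x // x ∉ U} → ℝ) (x : {x // x ∉ U}) :
    glue U a b x = b x := by
  simp [glue, x.2]

omit [Fintype V] in
lemma measurable_glue : Measurable fun z : (U → ℝ) × ({x // x ∉ U} → ℝ) => glue U z.1 z.2 :=
  (MeasurableEquiv.piEquivPiSubtypeProd (fun _ : V => ℝ) (· ∈ U)).symm.measurable

/-- The sum of the weights of the edges between `U` and its complement. -/
def crossWeight : ℝ := ∑ i : U, ∑ k : {x // x ∉ U}, 𝒢.weight i k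

open Classical in
/-- The contribution of a Schur complement `S` and of the potential `b` outside `U` to the density
of the random potential. -/
def schurDensity (S : Matrix {x // x ∉ U} {x // x ∉ U} ℝ) (b : {x // x ∉ U} → ℝ) : ℝ :=
  if S.PosDef then
    Real.sqrt (2 / Real.pi) ^ Fintype.card {x // x ∉ U}
      * Real.exp (-(1 / 2) * (∑ k, 2 * b k
        - ∑ k : {x // x ∉ U}, ∑ l : {x // x ∉ U}, 𝒢.weight k l) + 𝒢.crossWeight U)
      / Real.sqrt S.det
  else 0

/-- The conditional density of the potential outside `U` given the potential on `U`. -/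
def outerDensity (a : U → ℝ) (b : {x // x ∉ U} → ℝ) : ℝ := 𝒢.schurDensity U (𝒢.schur U a b) b

lemma schrodinger_quadratic_one_split (β : V → ℝ) :
    (fun _ => 1) ⬝ᵥ (𝒢.schrodinger β *ᵥ (fun _ => 1)) =
      (fun _ => 1) ⬝ᵥ ((𝒢.comap (Subtype.val : U → V)).schrodinger (fun x => β x) *ᵥ (fun _ => 1))
      + (∑ k : {x // x ∉ U}, 2 * β k - ∑ k : {x // x ∉ U}, ∑ l : {x // x ∉ U}, 𝒢.weight k l)
      - 2 * 𝒢.crossWeight U := by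
  have hc : ∑ k : {x // x ∉ U}, ∑ i : U, 𝒢.weight k i = 𝒢.crossWeight U := by
    rw [crossWeight, Finset.sum_comm]
    exact Finset.sum_congr rfl fun _ _ => Finset.sum_congr rfl fun _ _ => 𝒢.symm _ _
  rw [schrodinger_quadratic_one, schrodinger_quadratic_one, sum_split U,
    sum_split U (fun k => ∑ l, 𝒢.weight k l)]
  simp only [sum_split U (fun l => 𝒢.weight _ l), Finset.sum_add_distrib]
  rw [hc]
  simp only [comap, submatrix_apply, crossWeight]
  ring

/-- Definiteness and determinant split along the Schur complement, and the exponent is additive up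
to the edges across. The second factor need not have integral one in `b`, so the restriction of the
potential to `U` is in general a tilt of the potential law of the induced graph. -/
lemma potentialDensity_glue (a : U → ℝ) (b : {x // x ∉ U} → ℝ) :
    𝒢.potentialDensity (glue U a b) =
      (𝒢.comap (Subtype.val : U → V)).potentialDensity a * 𝒢.outerDensity U a b := by
  have hiff := 𝒢.posDef_schrodinger_iff U (glue U a b)
  have hdet := 𝒢.det_schrodinger_eq U (β := glue U a b)
  have hquad := 𝒢.schrodinger_quadratic_one_split U (glue U a b)
  simp only [glue_mem, glue_notMem] at hiff hdet hquad
  unfold potentialDensity outerDensity schurDensity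
  by_cases h1 : ((𝒢.comap (Subtype.val : U → V)).schrodinger a).PosDef
  · by_cases h2 : (𝒢.schur U a b).PosDef
    · rw [if_pos (hiff.2 ⟨h1, h2⟩), if_pos h1, if_pos h2, hdet h1, hquad,
        Real.sqrt_mul h1.det_pos.le, div_mul_div_comm]
      congr 1
      have hcard : Fintype.card V = Fintype.card U + Fintype.card {x // x ∉ U} := by
        rw [← Fintype.card_sum, Fintype.card_congr (Equiv.sumCompl (· ∈ U))]
      rw [hcard, pow_add, mul_mul_mul_comm, ← Real.exp_add]
      congr 2
      ring
    · rw [if_neg (fun h => h2 (hiff.1 h).2), if_neg h2, mul_zero]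
  · rw [if_neg (fun h => h1 (hiff.1 h).1), if_neg h1, zero_mul]

omit [Fintype V] in
lemma measurable_schur_apply (k l : {x // x ∉ U}) :
    Measurable fun z : (U → ℝ) × ({x // x ∉ U} → ℝ) => 𝒢.schur U z.1 z.2 k l := by
  simp only [schur, Matrix.sub_apply, Matrix.mul_apply]
  refine (measurable_schrodinger_apply _ measurable_snd _ _).sub
    (Finset.measurable_sum _ fun i _ => Measurable.mul_const
      (Finset.measurable_sum _ fun j _ => (measurable_green_apply _ measurable_fst _ _).const_mul _)
      _)

lemma measurable_schurDensity {α : Type*} [MeasurableSpace α]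
    {S : α → Matrix {x // x ∉ U} {x // x ∉ U} ℝ} {b : α → {x // x ∉ U} → ℝ}
    (hS : ∀ k l, Measurable fun z => S z k l) (hb : Measurable b) :
    Measurable fun z => 𝒢.schurDensity U (S z) (b z) := by
  refine Measurable.ite (measurableSet_posDef hS) ?_ measurable_const
  refine Measurable.div (Measurable.const_mul (Real.measurable_exp.comp ?_) _)
    (measurable_det_of_entries hS).sqrt
  refine Measurable.add_const (Measurable.const_mul (Measurable.sub_const ?_ _) _) _
  exact Finset.measurable_sum _ fun k _ => ((measurable_pi_apply k).comp hb).const_mul _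

lemma measurable_outerDensity :
    Measurable fun z : (U → ℝ) × ({x // x ∉ U} → ℝ) => 𝒢.outerDensity U z.1 z.2 :=
  𝒢.measurable_schurDensity U (𝒢.measurable_schur_apply U) measurable_snd

lemma lintegral_eq_lintegral_glue (F : (V → ℝ) → ENNReal) (hF : Measurable F) :
    ∫⁻ β, F β = ∫⁻ a : U → ℝ, ∫⁻ b : {x // x ∉ U} → ℝ, F (glue U a b) := by
  have h := (volume_preserving_piEquivPiSubtypeProd (fun _ : V => ℝ) (· ∈ U)).symm
  rw [← h.lintegral_comp hF]
  rw [Measure.volume_eq_prod, lintegral_prod]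
  · rw [Subsingleton.elim (Subtype.fintype fun x => x ∈ U) (Finset.Subtype.fintype U)]
    rfl
  · exact (hF.comp (MeasurableEquiv.measurable _)).aemeasurable

/-- Disintegration of the potential along the restriction to `U`. -/
lemma lintegral_potentialLaw_glue (F : (V → ℝ) → ENNReal) (hF : Measurable F) :
    ∫⁻ β, F β ∂𝒢.potentialLaw =
      ∫⁻ a, (∫⁻ b, ENNReal.ofReal (𝒢.outerDensity U a b) * F (glue U a b))
        ∂(𝒢.comap (Subtype.val : U → V)).potentialLaw := by
  rw [lintegral_potentialLaw, lintegral_potentialLaw, lintegral_eq_lintegral_glue U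
    (fun β => ENNReal.ofReal (𝒢.potentialDensity β) * F β)
    (𝒢.measurable_potentialDensity.ennreal_ofReal.mul hF)]
  refine lintegral_congr fun a => ?_
  rw [← lintegral_const_mul' _ _ ENNReal.ofReal_ne_top]
  refine lintegral_congr fun b => ?_
  simp only [potentialDensity_glue, ENNReal.ofReal_mul (potentialDensity_nonneg _ _), mul_assoc]

/-- With `b` outside, the inner integral is over the potential law of the graph induced on `U`,
where the identity for row sums applies. -/
lemma lintegral_potentialLaw_glue_swap (F : (V → ℝ) → ENNReal) (hF : Measurable F) :
    ∫⁻ β, F β ∂𝒢.potentialLaw =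
      ∫⁻ b, ∫⁻ a, ENNReal.ofReal (𝒢.outerDensity U a b) * F (glue U a b)
        ∂(𝒢.comap (Subtype.val : U → V)).potentialLaw := by
  rw [lintegral_potentialLaw_glue 𝒢 U F hF, potentialLaw]
  rw [lintegral_lintegral_swap]
  exact ((𝒢.measurable_outerDensity U).ennreal_ofReal.mul
    (hF.comp (measurable_glue U))).aemeasurable

end Block

end WeightedGraph
end H22
end

noncomputable section

open Matrix

namespace H22.WeightedGraph

variable {V : Type*} [Fintype V] [DecidableEq V] (𝒢 : WeightedGraph V)

/-! ### Removing one vertex -/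

section Vertex

variable (i : V)

/-- Removing `i` is the block decomposition for `{i}ᶜ`; its Schur complement is then a scalar. -/
instance uniqueCompl : Unique {x // x ∉ ({i}ᶜ : Finset V)} where
  default := ⟨i, by simp⟩
  uniq x := Subtype.ext (by simpa using x.2)

lemma sum_compl_singleton (f : V → ℝ) :
    ∑ x, f x = ∑ x : ({i}ᶜ : Finset V), f x + f i := by
  rw [sum_split ({i}ᶜ : Finset V)]
  congr 1
  exact Fintype.sum_unique _

variable {i} in
lemma ne_of_mem_compl_singleton (k : ({i}ᶜ : Finset V)) :
    (k : V) ≠ i := by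
  have := k.2
  rwa [Finset.mem_compl, Finset.mem_singleton] at this

/-- The graph with the vertex `i` removed. -/
abbrev erase : WeightedGraph ({i}ᶜ : Finset V) := 𝒢.comap Subtype.val

/-- The weights of the edges from `i` to the other vertices. -/
def link : ({i}ᶜ : Finset V) → ℝ := fun k => 𝒢.weight i k

/-- The restriction of a vector to the complement of the vertex `i`. -/
abbrev off (x : V → ℝ) : ({i}ᶜ : Finset V) → ℝ := fun k => x k

/-- The quadratic form of the Green matrix off `i` at the link vector of `i`. -/
def linkForm (a : ({i}ᶜ : Finset V) → ℝ) : ℝ :=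
  𝒢.link i ⬝ᵥ ((𝒢.erase i).green a *ᵥ 𝒢.link i)

variable {i}

lemma erase_posDef {β : V → ℝ} (h : (𝒢.schrodinger β).PosDef) :
    ((𝒢.erase i).schrodinger (off i β)).PosDef :=
  𝒢.posDef_comap (f := (Subtype.val : ({i}ᶜ : Finset V) → V)) Subtype.val_injective h

lemma erase_schrodinger_mulVec (β x : V → ℝ) (k : ({i}ᶜ : Finset V)) :
    ((𝒢.erase i).schrodinger (off i β) *ᵥ off i x) k =
      (𝒢.schrodinger β *ᵥ x) k + x i * 𝒢.link i k := by
  rw [schrodinger_mulVec_apply, schrodinger_mulVec_apply, sum_compl_singleton i]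
  simp only [erase, comap, submatrix_apply, link, off, 𝒢.symm i k]
  ring

/-- In the rows other than `i` of `Hx = η`, the column `i` moves to the right-hand side, where it
acts as a source `x i • link`. -/
lemma off_green_mulVec {β : V → ℝ} (h : (𝒢.schrodinger β).PosDef) (η : V → ℝ) :
    off i (𝒢.green β *ᵥ η) = (𝒢.erase i).green (off i β) *ᵥ
      (off i η + (𝒢.green β *ᵥ η) i • 𝒢.link i) := by
  refine (green_mulVec_eq (𝒢.erase_posDef h) ?_).symm
  ext k
  rw [erase_schrodinger_mulVec, schrodinger_mulVec_green h]
  rfl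

lemma green_mulVec_vertex {β : V → ℝ} (h : (𝒢.schrodinger β).PosDef) (η : V → ℝ) :
    (2 * β i - 𝒢.linkForm i (off i β)) * (𝒢.green β *ᵥ η) i =
      η i + 𝒢.link i ⬝ᵥ ((𝒢.erase i).green (off i β) *ᵥ off i η) := by
  have h1 := congrFun (schrodinger_mulVec_green h η) i
  rw [schrodinger_mulVec_apply, sum_compl_singleton i, 𝒢.diag] at h1
  have h2 : ∑ x : ({i}ᶜ : Finset V), 𝒢.weight i x * (𝒢.green β *ᵥ η) x =
      𝒢.link i ⬝ᵥ off i (𝒢.green β *ᵥ η) := rfl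
  rw [h2, off_green_mulVec 𝒢 h, mulVec_add, mulVec_smul, dotProduct_add, dotProduct_smul,
    smul_eq_mul] at h1
  rw [linkForm]
  linarith

/-- Taking `η` to be the unit vector at `i` identifies `1 / G(i, i)` with the scalar Schur
complement. Given the potential off `i`, `γ` is therefore a translate of `β i`. -/
lemma two_mul_pinGamma {β : V → ℝ} (h : (𝒢.schrodinger β).PosDef) :
    2 * 𝒢.pinGamma β i = 2 * β i - 𝒢.linkForm i (off i β) := by
  have h1 := 𝒢.green_mulVec_vertex h (Pi.single i 1) (i := i)
  have h2 : off i (Pi.single i 1 : V → ℝ) = 0 := by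
    ext k
    simp [ne_of_mem_compl_singleton k]
  rw [h2, mulVec_zero, dotProduct_zero, add_zero, mulVec_single_one, Pi.single_eq_same] at h1
  have h3 := (green_diag_pos h i).ne'
  have h4 : (2 * β i - 𝒢.linkForm i (off i β)) * 𝒢.green β i i = 1 := h1
  rw [pinGamma]
  field_simp
  linarith

lemma pinGamma_pos {β : V → ℝ} (h : (𝒢.schrodinger β).PosDef) : 0 < 𝒢.pinGamma β i := by
  have := green_diag_pos h i
  rw [pinGamma]; positivity

lemma green_mulVec_pin {β : V → ℝ} (h : (𝒢.schrodinger β).PosDef) (η : V → ℝ) :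
    (𝒢.green β *ᵥ η) i = (η i + 𝒢.link i ⬝ᵥ ((𝒢.erase i).green (off i β) *ᵥ off i η)) /
      (2 * 𝒢.pinGamma β i) := by
  have := 𝒢.pinGamma_pos h (i := i)
  rw [← green_mulVec_vertex 𝒢 h, ← two_mul_pinGamma 𝒢 h]
  field_simp

/-- This isolates the dependence on `γ`: everything else on the right involves only the potential
off `i`. -/
lemma green_quadratic_vertex {β : V → ℝ} (h : (𝒢.schrodinger β).PosDef) (η : V → ℝ) :
    η ⬝ᵥ (𝒢.green β *ᵥ η) =
      off i η ⬝ᵥ ((𝒢.erase i).green (off i β) *ᵥ off i η) +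
        (η i + 𝒢.link i ⬝ᵥ ((𝒢.erase i).green (off i β) *ᵥ off i η)) ^ 2 /
          (2 * 𝒢.pinGamma β i) := by
  have h1 : η ⬝ᵥ (𝒢.green β *ᵥ η) =
      off i η ⬝ᵥ off i (𝒢.green β *ᵥ η) + η i * (𝒢.green β *ᵥ η) i :=
    sum_compl_singleton i _
  rw [h1, off_green_mulVec 𝒢 h, mulVec_add, mulVec_smul, dotProduct_add, dotProduct_smul,
    smul_eq_mul, green_quadratic_comm _ _ (off i η) (𝒢.link i), green_mulVec_pin 𝒢 h]
  ring

/-- The exponentials of the `u`-field pinned at `i`, away from `i`. -/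
lemma green_ratio {β : V → ℝ} (h : (𝒢.schrodinger β).PosDef) (k : ({i}ᶜ : Finset V)) :
    𝒢.green β k i / 𝒢.green β i i = ((𝒢.erase i).green (off i β) *ᵥ 𝒢.link i) k := by
  have h1 := congrFun (𝒢.off_green_mulVec h (Pi.single i 1) (i := i)) k
  have h2 : off i (Pi.single i 1 : V → ℝ) = 0 := by
    ext k
    simp [ne_of_mem_compl_singleton k]
  rw [h2, zero_add, mulVec_smul, off, mulVec_single_one] at h1
  rw [div_eq_iff (green_diag_pos h i).ne']
  exact h1.trans (mul_comm _ _)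

lemma schur_vertex (a : ({i}ᶜ : Finset V) → ℝ) (b : {x // x ∉ ({i}ᶜ : Finset V)} → ℝ) :
    𝒢.schur {i}ᶜ a b default default = 2 * b default - 𝒢.linkForm i a := by
  have h1 : (𝒢.comap (Subtype.val : {x // x ∉ ({i}ᶜ : Finset V)} → V)).schrodinger b
      default default = 2 * b default := by
    simp [schrodinger, comap, 𝒢.diag]
  have h2 : ∀ k, 𝒢.offBlock {i}ᶜ k default = - 𝒢.link i k := fun k => by
    rw [offBlock, link, 𝒢.symm]; rfl
  rw [schur, Matrix.sub_apply, h1, linkForm, dotProduct_mulVec, Matrix.mul_apply]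
  congr 1
  refine Finset.sum_congr rfl fun k _ => ?_
  simp only [Matrix.mul_apply, conjTranspose_apply, h2, vecMul, dotProduct, star_trivial]
  simp

lemma posDef_unique_iff {n : Type*} [Fintype n] [Unique n] (M : Matrix n n ℝ) :
    M.PosDef ↔ 0 < M default default := by
  constructor
  · exact fun h => h.diag_pos
  · intro h
    refine PosDef.of_dotProduct_mulVec_pos ?_ fun x hx => ?_
    · ext i j; rw [Subsingleton.elim i default, Subsingleton.elim j default]; simp
    · have hx' : x default ≠ 0 := fun h0 => hx (funext fun j => by
        rw [Subsingleton.elim j default, h0]; rfl)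
      simp only [dotProduct, mulVec, Fintype.sum_unique, star_trivial]
      nlinarith [mul_pos h (mul_self_pos.2 hx')]

/-- With `c = t - linkForm / 2` the Schur complement is `2c`, and `√(2/π) e^{-c} / √(2c)` is the
Gamma density of shape 1/2 and rate 1. -/
lemma outerDensity_vertex (a : ({i}ᶜ : Finset V) → ℝ) (t : ℝ) :
    𝒢.outerDensity {i}ᶜ a (fun _ => t) =
      Real.exp (∑ k, 𝒢.link i k - 𝒢.linkForm i a / 2) *
        gammaPDFReal (1 / 2) 1 (t - 𝒢.linkForm i a / 2) := by
  unfold outerDensity schurDensity gammaPDFReal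
  rw [posDef_unique_iff, det_unique, schur_vertex]
  set c := t - 𝒢.linkForm i a / 2 with hc
  have h2c : 2 * t - 𝒢.linkForm i a = 2 * c := by rw [hc]; ring
  have hcross : 𝒢.crossWeight {i}ᶜ = ∑ k, 𝒢.link i k := by
    simp only [crossWeight, Fintype.sum_unique, link]
    exact Finset.sum_congr rfl fun k _ => 𝒢.symm _ _
  rw [h2c]
  rcases lt_trichotomy c 0 with h | h | h
  · rw [if_neg (by linarith), if_neg (by linarith), mul_zero]
  -- At `c = 0` the Gamma density vanishes as well, since `0 ^ (-1/2) = 0` for the real power.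
  · rw [if_neg (by linarith), if_pos h.ge, h, Real.zero_rpow (by norm_num)]
    simp
  · rw [if_pos (by linarith), if_pos h.le]
    simp only [Fintype.sum_unique, 𝒢.diag, sub_zero, Fintype.card_unique, pow_one, hcross]
    have e1 : -(1 / 2) * (2 * t) + ∑ k, 𝒢.link i k =
        (∑ k, 𝒢.link i k - 𝒢.linkForm i a / 2) + -(1 * c) := by rw [hc]; ring
    rw [e1, Real.exp_add, Real.one_rpow, Real.Gamma_one_half_eq, Real.sqrt_div' _ Real.pi_pos.le,
      Real.sqrt_mul' _ h.le, show (1 / 2 - 1 : ℝ) = -(1 / 2) by norm_num, Real.rpow_neg h.le,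
      ← Real.sqrt_eq_rpow]
    have := Real.sqrt_pos.2 h
    have := Real.sqrt_pos.2 Real.pi_pos
    have := Real.sqrt_pos.2 (zero_lt_two' ℝ)
    field_simp

lemma measurable_pinGamma {α : Type*} [MeasurableSpace α] {β : α → V → ℝ} (hβ : Measurable β)
    (i : V) : Measurable fun x => 𝒢.pinGamma (β x) i :=
  ((𝒢.measurable_green_apply hβ i i).const_mul 2).const_div 1

lemma measurable_off (i : V) : Measurable (off i) :=
  measurable_pi_lambda _ fun _ => measurable_pi_apply _

/-- The variable `γ` is Gamma distributed and independent of the potential off `i`, whose density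
with respect to the potential law of the graph without `i` is explicit. -/
lemma lintegral_potentialLaw_vertex (i : V) (F : (({i}ᶜ : Finset V) → ℝ) × ℝ → ENNReal)
    (hF : Measurable F) :
    ∫⁻ β, F (off i β, 𝒢.pinGamma β i) ∂𝒢.potentialLaw =
      ∫⁻ a, ENNReal.ofReal (Real.exp (∑ k, 𝒢.link i k - 𝒢.linkForm i a / 2)) *
        ∫⁻ c, F (a, c) ∂gammaMeasure (1 / 2) 1 ∂(𝒢.erase i).potentialLaw := by
  rw [lintegral_potentialLaw_glue 𝒢 {i}ᶜ (fun β => F (off i β, 𝒢.pinGamma β i))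
    (hF.comp ((measurable_off i).prodMk (𝒢.measurable_pinGamma measurable_id i)))]
  refine lintegral_congr_ae ?_
  filter_upwards [(𝒢.erase i).ae_posDef] with a ha
  have hΓ : ∫⁻ c, F (a, c) ∂gammaMeasure (1 / 2) 1 =
      ∫⁻ c, gammaPDF (1 / 2) 1 c * F (a, c) :=
    lintegral_withDensity_eq_lintegral_mul _
      (measurable_gammaPDFReal _ _).ennreal_ofReal (hF.comp measurable_prodMk_left)
  -- Translate from the variable `γ` to `t = β i = γ + linkForm / 2`.
  rw [hΓ, ← lintegral_const_mul' _ _ ENNReal.ofReal_ne_top,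
    ← lintegral_sub_right_eq_self _ (𝒢.linkForm i a / 2)]
  have hvp : MeasurePreserving
      (MeasurableEquiv.funUnique {x // x ∉ ({i}ᶜ : Finset V)} ℝ).symm volume volume := by
    convert (volume_preserving_funUnique {x // x ∉ ({i}ᶜ : Finset V)} ℝ).symm
  rw [← hvp.lintegral_comp_emb (MeasurableEquiv.measurableEmbedding _)]
  refine lintegral_congr fun t => ?_
  have ht : (MeasurableEquiv.funUnique {x // x ∉ ({i}ᶜ : Finset V)} ℝ).symm t = fun _ => t := by
    ext; rfl
  rw [ht, outerDensity_vertex, ENNReal.ofReal_mul (Real.exp_pos _).le, mul_assoc]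
  congr 1
  simp only [gammaPDF]
  have hoff : off i (glue {i}ᶜ a fun _ => t) = a := funext fun k => glue_mem _ _ _ _
  rw [hoff]
  -- Only for `c > 0` is the glued operator definite and `γ` identified with `c`; otherwise the
  -- density is zero.
  by_cases hc : 0 < t - 𝒢.linkForm i a / 2
  · have hH : (𝒢.schrodinger (glue {i}ᶜ a fun _ => t)).PosDef := by
      have hS : (𝒢.schur {i}ᶜ a fun _ => t).PosDef := by
        rw [posDef_unique_iff, schur_vertex]
        linarith
      rw [posDef_schrodinger_iff 𝒢 {i}ᶜ]
      simp only [glue_mem, glue_notMem]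
      exact ⟨ha, hS⟩
    have h1 := 𝒢.two_mul_pinGamma hH (i := i)
    have h2 : glue {i}ᶜ a (fun _ => t) i = t := by simp [glue]
    rw [hoff, h2] at h1
    rw [show 𝒢.pinGamma (glue {i}ᶜ a fun _ => t) i = t - 𝒢.linkForm i a / 2 by linarith]
  · have h0 : gammaPDFReal (1 / 2) 1 (t - 𝒢.linkForm i a / 2) = 0 := by
      rw [gammaPDFReal]
      rcases lt_or_eq_of_le (not_lt.1 hc) with h | h
      · rw [if_neg (by linarith)]
      · rw [h, if_pos le_rfl, Real.zero_rpow (by norm_num)]; simp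
    rw [h0]; simp

end Vertex

end H22.WeightedGraph
end

/-! ### A Laplace transform for the Gamma law of shape 1/2, by the Cauchy–Schlömilch substitution.
-/

noncomputable section

namespace H22

open Real Set

section OneDim

/-- The positive root of `x - b / x = u`. -/
def schlomilchRoot (b u : ℝ) : ℝ := (u + √(u ^ 2 + 4 * b)) / 2

variable {b : ℝ}

lemma abs_lt_sqrt_schlomilch (hb : 0 < b) (u : ℝ) : |u| < √(u ^ 2 + 4 * b) := by
  rw [← sqrt_sq_eq_abs]
  exact sqrt_lt_sqrt (sq_nonneg u) (by linarith)

lemma schlomilchRoot_pos (hb : 0 < b) (u : ℝ) : 0 < schlomilchRoot b u := by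
  have := abs_lt_sqrt_schlomilch hb u
  have := neg_abs_le u
  rw [schlomilchRoot]; linarith

lemma schlomilchRoot_spec (hb : 0 < b) (u : ℝ) :
    schlomilchRoot b u - b / schlomilchRoot b u = u := by
  have h := schlomilchRoot_pos hb u
  have h2 : √(u ^ 2 + 4 * b) ^ 2 = u ^ 2 + 4 * b := sq_sqrt (by positivity)
  rw [sub_eq_iff_eq_add, ← sub_eq_iff_eq_add', eq_div_iff h.ne', schlomilchRoot]
  nlinarith

lemma schlomilchRoot_sub_div {x : ℝ} (hb : 0 < b) (hx : 0 < x) :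
    schlomilchRoot b (x - b / x) = x := by
  have h : (x - b / x) ^ 2 + 4 * b = (x + b / x) ^ 2 := by field_simp; ring
  rw [schlomilchRoot, h, sqrt_sq (by positivity)]
  ring

lemma image_schlomilchRoot_sq (hb : 0 < b) :
    (fun u => schlomilchRoot b u ^ 2) '' univ = Ioi 0 := by
  ext c
  constructor
  · rintro ⟨u, -, rfl⟩
    exact pow_pos (schlomilchRoot_pos hb u) 2
  · intro hc
    refine ⟨√c - b / √c, mem_univ _, ?_⟩
    simp only [schlomilchRoot_sub_div hb (sqrt_pos.2 hc), sq_sqrt (le_of_lt hc)]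

lemma injective_schlomilchRoot_sq (hb : 0 < b) :
    Function.Injective fun u => schlomilchRoot b u ^ 2 := by
  intro u v h
  have h1 : schlomilchRoot b u = schlomilchRoot b v :=
    (pow_left_inj₀ (schlomilchRoot_pos hb u).le (schlomilchRoot_pos hb v).le two_ne_zero).1 h
  rw [← schlomilchRoot_spec hb u, ← schlomilchRoot_spec hb v, h1]

lemma hasDerivAt_schlomilchRoot_sq (hb : 0 < b) (u : ℝ) :
    HasDerivAt (fun u => schlomilchRoot b u ^ 2)
      (schlomilchRoot b u * (1 + u / √(u ^ 2 + 4 * b))) u := by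
  have h0 : u ^ 2 + 4 * b ≠ 0 := by positivity
  have h1 : HasDerivAt (fun u : ℝ => u ^ 2 + 4 * b) (2 * u) u := by
    simpa using (hasDerivAt_pow 2 u).add_const (4 * b)
  have h2 := (((hasDerivAt_id u).add (h1.sqrt h0)).div_const 2).pow 2
  refine h2.congr_deriv ?_
  simp only [id, schlomilchRoot, Pi.add_apply]
  have : 0 < √(u ^ 2 + 4 * b) := sqrt_pos.2 (by positivity)
  field_simp
  ring

/-- A Laplace transform of the inverse Gamma distribution with shape `1 / 2`. -/
lemma lintegral_exp_gammaMeasure_of_pos (hb : 0 < b) :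
    ∫⁻ c, ENNReal.ofReal (rexp (-(b ^ 2 / c))) ∂gammaMeasure (1 / 2) 1 =
      ENNReal.ofReal (rexp (-(2 * b))) := by
  have h1 : ∫⁻ c, ENNReal.ofReal (rexp (-(b ^ 2 / c))) ∂gammaMeasure (1 / 2) 1 =
      ∫⁻ c in Ioi 0, ENNReal.ofReal (gammaPDFReal (1 / 2) 1 c * rexp (-(b ^ 2 / c))) := by
    have : ∫⁻ c, ENNReal.ofReal (rexp (-(b ^ 2 / c))) ∂gammaMeasure (1 / 2) 1 =
        ∫⁻ c, gammaPDF (1 / 2) 1 c * ENNReal.ofReal (rexp (-(b ^ 2 / c))) :=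
      lintegral_withDensity_eq_lintegral_mul _
        (measurable_gammaPDFReal _ _).ennreal_ofReal (by fun_prop)
    rw [this, ← lintegral_indicator measurableSet_Ioi]
    refine lintegral_congr fun c => ?_
    by_cases hc : 0 < c
    · rw [indicator_of_mem (show c ∈ Ioi 0 from hc), gammaPDF,
        ENNReal.ofReal_mul (gammaPDFReal_nonneg (by norm_num) one_pos _)]
    · rw [indicator_of_notMem (show c ∉ Ioi 0 from hc), gammaPDF, gammaPDFReal]
      rcases lt_or_eq_of_le (not_lt.1 hc) with h | h
      · rw [if_neg (by linarith)]; simp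
      · rw [h, if_pos le_rfl, zero_rpow (by norm_num)]; simp
  -- Substitute `c = x²` with `x - b / x = u`: then `c + b² / c = u² + 2b`, the Jacobian cancels `c
  -- ^ (-1/2)` and leaves `1 + u / √(u² + 4b)`. The second term is odd and integrates to zero, so a
  -- Gaussian integral remains.
  have h2 : ∀ u, |schlomilchRoot b u * (1 + u / √(u ^ 2 + 4 * b))| *
      (gammaPDFReal (1 / 2) 1 (schlomilchRoot b u ^ 2) *
        rexp (-(b ^ 2 / schlomilchRoot b u ^ 2))) =
      rexp (-(2 * b)) / √π * (rexp (-1 * u ^ 2) + rexp (-1 * u ^ 2) * (u / √(u ^ 2 + 4 * b))) := by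
    intro u
    have hr := schlomilchRoot_pos hb u
    have hs : 0 < √(u ^ 2 + 4 * b) := sqrt_pos.2 (by positivity)
    have hlt := abs_lt_sqrt_schlomilch hb u
    have hd : 0 ≤ 1 + u / √(u ^ 2 + 4 * b) := by
      have : -1 ≤ u / √(u ^ 2 + 4 * b) := by
        rw [le_div_iff₀ hs]; linarith [neg_abs_le u]
      linarith
    rw [abs_of_nonneg (mul_nonneg hr.le hd), gammaPDFReal, if_pos (by positivity), one_rpow,
      Real.Gamma_one_half_eq, show (1 / 2 - 1 : ℝ) = -(1 / 2) by norm_num,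
      rpow_neg (by positivity), ← sqrt_eq_rpow, sqrt_sq hr.le]
    have he : -(1 * schlomilchRoot b u ^ 2) + -(b ^ 2 / schlomilchRoot b u ^ 2) =
        -(2 * b) + -1 * u ^ 2 := by
      conv_rhs => rw [← schlomilchRoot_spec hb u]
      field_simp
      ring
    calc _ = (1 + u / √(u ^ 2 + 4 * b)) / √π *
          (rexp (-(1 * schlomilchRoot b u ^ 2)) * rexp (-(b ^ 2 / schlomilchRoot b u ^ 2))) := by
          field_simp
      _ = _ := by rw [← exp_add, he, exp_add]; ring
  have hg : Integrable fun u : ℝ => rexp (-1 * u ^ 2) := integrable_exp_neg_mul_sq one_pos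
  have hg2 : Integrable fun u : ℝ => rexp (-1 * u ^ 2) * (u / √(u ^ 2 + 4 * b)) := by
    refine hg.mul_bdd (c := 1)
      (Measurable.aestronglyMeasurable (by fun_prop)) (Filter.Eventually.of_forall fun u => ?_)
    have hs : 0 < √(u ^ 2 + 4 * b) := sqrt_pos.2 (by positivity)
    rw [norm_eq_abs, abs_div, abs_of_pos hs, div_le_one hs]
    exact (abs_lt_sqrt_schlomilch hb u).le
  have hodd : ∫ u : ℝ, rexp (-1 * u ^ 2) * (u / √(u ^ 2 + 4 * b)) = 0 := by
    have := integral_neg_eq_self (fun u : ℝ => rexp (-1 * u ^ 2) * (u / √(u ^ 2 + 4 * b))) volume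
    simp only [neg_sq, neg_div, mul_neg, integral_neg] at this
    linarith
  have hnn : ∀ u, 0 ≤ rexp (-(2 * b)) / √π *
      (rexp (-1 * u ^ 2) + rexp (-1 * u ^ 2) * (u / √(u ^ 2 + 4 * b))) := fun u => by
    rw [← h2]
    exact mul_nonneg (abs_nonneg _)
      (mul_nonneg (gammaPDFReal_nonneg (by norm_num) one_pos _) (exp_pos _).le)
  rw [h1, ← image_schlomilchRoot_sq hb, lintegral_image_eq_lintegral_abs_deriv_mul
    MeasurableSet.univ (fun u _ => (hasDerivAt_schlomilchRoot_sq hb u).hasDerivWithinAt)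
    (injective_schlomilchRoot_sq hb).injOn]
  simp only [← ENNReal.ofReal_mul (abs_nonneg _), h2]
  have hint : Integrable fun u : ℝ => rexp (-(2 * b)) / √π *
      (rexp (-1 * u ^ 2) + rexp (-1 * u ^ 2) * (u / √(u ^ 2 + 4 * b))) := (hg.add hg2).const_mul _
  rw [Measure.restrict_univ, ← ofReal_integral_eq_lintegral_ofReal hint
    (Filter.Eventually.of_forall hnn),
    integral_const_mul, integral_add hg hg2, hodd, integral_gaussian, div_one, add_zero]
  have := sqrt_pos.2 pi_pos
  field_simp

lemma lintegral_exp_gammaMeasure {a : ℝ} (ha : 0 ≤ a) :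
    ∫⁻ c, ENNReal.ofReal (rexp (-(a ^ 2 / (4 * c)))) ∂gammaMeasure (1 / 2) 1 =
      ENNReal.ofReal (rexp (-a)) := by
  rcases ha.eq_or_lt with rfl | ha
  · have := isProbabilityMeasure_gammaMeasure (a := 1 / 2) (r := 1) (by norm_num) one_pos
    simpa using measure_univ (μ := gammaMeasure (1 / 2) 1)
  · have := lintegral_exp_gammaMeasure_of_pos (half_pos ha)
    convert this using 5
    · ring
    · ring

end OneDim

end H22
end

/-! ### Laplace transform of the potential law, its normalisation, and the law of `γ`. -/

noncomputable section

open Matrix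

namespace H22.WeightedGraph

universe u

/-- The Laplace transform of the potential law. -/
theorem lintegral_exp_green_quadratic (n : ℕ) : ∀ {V : Type u} [Fintype V] [DecidableEq V]
    (𝒢 : WeightedGraph V) (_ : Fintype.card V = n) {η : V → ℝ} (_ : ∀ k, 0 ≤ η k),
    ∫⁻ β, ENNReal.ofReal (Real.exp (-(η ⬝ᵥ (𝒢.green β *ᵥ η)) / 2)) ∂𝒢.potentialLaw =
      ENNReal.ofReal (Real.exp (-∑ k, η k)) := by
  induction n with
  | zero =>
    intro V _ _ 𝒢 hn η hη
    have : IsEmpty V := Fintype.card_eq_zero_iff.1 hn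
    have hpd : ∀ β, (𝒢.schrodinger β).PosDef := fun β =>
      PosDef.of_dotProduct_mulVec_pos (𝒢.schrodinger_isHermitian β)
        fun x hx => (hx (Subsingleton.elim _ _)).elim
    rw [lintegral_potentialLaw, volume_pi, Measure.pi_of_empty, lintegral_dirac]
    simp [potentialDensity, hpd]
  | succ n ih =>
    intro V _ _ 𝒢 hn η hη
    obtain ⟨i⟩ : Nonempty V := Fintype.card_pos_iff.1 (by omega)
    set q : (({i}ᶜ : Finset V) → ℝ) → ℝ := fun a =>
      off i η ⬝ᵥ ((𝒢.erase i).green a *ᵥ off i η) with hq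
    set m : (({i}ᶜ : Finset V) → ℝ) → ℝ := fun a =>
      𝒢.link i ⬝ᵥ ((𝒢.erase i).green a *ᵥ off i η) with hm
    have hqm : Measurable q := (𝒢.erase i).measurable_green_quadratic measurable_id _ _
    have hmm : Measurable m := (𝒢.erase i).measurable_green_quadratic measurable_id _ _
    have hlink : ∀ k, 0 ≤ 𝒢.link i k := fun k => 𝒢.nonneg _ _
    let F : (({i}ᶜ : Finset V) → ℝ) × ℝ → ENNReal := fun z =>
      ENNReal.ofReal (Real.exp (-q z.1 / 2)) *
        ENNReal.ofReal (Real.exp (-((η i + m z.1) ^ 2 / (4 * z.2))))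
    have hF : Measurable F := by fun_prop
    have h1 : ∫⁻ β, ENNReal.ofReal (Real.exp (-(η ⬝ᵥ (𝒢.green β *ᵥ η)) / 2)) ∂𝒢.potentialLaw =
        ∫⁻ β, F (off i β, 𝒢.pinGamma β i) ∂𝒢.potentialLaw := by
      refine lintegral_congr_ae ?_
      filter_upwards [𝒢.ae_posDef] with β hβ
      simp only [F]
      rw [← ENNReal.ofReal_mul (Real.exp_pos _).le, ← Real.exp_add,
        green_quadratic_vertex 𝒢 hβ (i := i)]
      congr 2
      have := 𝒢.pinGamma_pos hβ (i := i)
      simp only [hq, hm]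
      field_simp
      ring
    have hcard : Fintype.card ({i}ᶜ : Finset V) = n := by
      rw [Fintype.card_coe, Finset.card_compl, Finset.card_singleton, hn]; rfl
    have hη' : ∀ k, 0 ≤ (off i η + 𝒢.link i) k := fun k => add_nonneg (hη _) (hlink _)
    rw [h1, lintegral_potentialLaw_vertex 𝒢 i F hF]
    -- Integrating out `γ` gives `exp(-(η i + m))`. Here `m` is the cross term and `linkForm / 2`,
    -- from the density, the remaining square that complete `q / 2` to half the quadratic form at
    -- `off i η + link`. The induction hypothesis applies to this vector, and the sums of `link`
    -- cancel.
    have h2 : ∀ᵐ a ∂(𝒢.erase i).potentialLaw,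
        ENNReal.ofReal (Real.exp (∑ k, 𝒢.link i k - 𝒢.linkForm i a / 2)) *
          ∫⁻ c, F (a, c) ∂gammaMeasure (1 / 2) 1 =
        ENNReal.ofReal (Real.exp (∑ k, 𝒢.link i k - η i)) *
          ENNReal.ofReal (Real.exp (-((off i η + 𝒢.link i) ⬝ᵥ
            ((𝒢.erase i).green a *ᵥ (off i η + 𝒢.link i))) / 2)) := by
      filter_upwards [(𝒢.erase i).ae_posDef] with a ha
      have hma : 0 ≤ m a := dotProduct_nonneg_of_nonneg hlink
        (fun k => green_mulVec_nonneg ha (fun k => hη _) k)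
      simp only [F]
      rw [lintegral_const_mul' _ _ ENNReal.ofReal_ne_top,
        lintegral_exp_gammaMeasure (add_nonneg (hη i) hma)]
      simp only [← ENNReal.ofReal_mul (Real.exp_pos _).le, ← Real.exp_add]
      congr 2
      rw [mulVec_add, add_dotProduct, dotProduct_add, dotProduct_add,
        green_quadratic_comm _ _ (off i η) (𝒢.link i)]
      simp only [hq, hm, linkForm]
      ring
    rw [lintegral_congr_ae h2, lintegral_const_mul' _ _ ENNReal.ofReal_ne_top,
      ih (𝒢.erase i) hcard hη', ← ENNReal.ofReal_mul (Real.exp_pos _).le, ← Real.exp_add]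
    congr 2
    rw [sum_compl_singleton i η]
    simp only [Pi.add_apply, Finset.sum_add_distrib, off]
    ring

variable {V : Type*} [Fintype V] [DecidableEq V] (𝒢 : WeightedGraph V)

instance isProbabilityMeasure_potentialLaw : IsProbabilityMeasure 𝒢.potentialLaw := by
  constructor
  simpa using lintegral_exp_green_quadratic _ 𝒢 rfl (η := 0) (fun _ => le_rfl)

lemma measurable_exp_green_quadratic (η : V → ℝ) :
    Measurable fun β => Real.exp (-(η ⬝ᵥ (𝒢.green β *ᵥ η)) / 2) :=
  ((𝒢.measurable_green_quadratic measurable_id η η).neg.div_const 2).exp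

lemma integral_exp_green_quadratic {η : V → ℝ} (hη : ∀ k, 0 ≤ η k) :
    ∫ β, Real.exp (-(η ⬝ᵥ (𝒢.green β *ᵥ η)) / 2) ∂𝒢.potentialLaw =
      Real.exp (-∑ k, η k) := by
  rw [integral_eq_lintegral_of_nonneg_ae (Filter.Eventually.of_forall fun _ => (Real.exp_pos _).le)
    (𝒢.measurable_exp_green_quadratic η).aestronglyMeasurable,
    lintegral_exp_green_quadratic _ 𝒢 rfl hη, ENNReal.toReal_ofReal (Real.exp_pos _).le]

lemma integrable_exp_green_quadratic {η : V → ℝ} (hη : ∀ k, 0 ≤ η k) :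
    Integrable (fun β => Real.exp (-(η ⬝ᵥ (𝒢.green β *ᵥ η)) / 2)) 𝒢.potentialLaw := by
  refine ⟨(𝒢.measurable_exp_green_quadratic η).aestronglyMeasurable, ?_⟩
  rw [hasFiniteIntegral_iff_ofReal (Filter.Eventually.of_forall fun _ => (Real.exp_pos _).le),
    lintegral_exp_green_quadratic _ 𝒢 rfl hη]
  exact ENNReal.ofReal_lt_top

/-- Integrating out the potential off `i` leaves a multiple `C` of the Gamma law; comparing total
masses gives `C = 1`. -/
lemma map_pinGamma_potentialLaw (i : V) :
    𝒢.potentialLaw.map (fun β => 𝒢.pinGamma β i) = gammaMeasure (1 / 2) 1 := by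
  have := isProbabilityMeasure_gammaMeasure (a := 1 / 2) (r := 1) (by norm_num) one_pos
  have hm : Measurable fun β => 𝒢.pinGamma β i := 𝒢.measurable_pinGamma measurable_id i
  set C := ∫⁻ a, ENNReal.ofReal (Real.exp (∑ k, 𝒢.link i k - 𝒢.linkForm i a / 2))
    ∂(𝒢.erase i).potentialLaw with hC
  have h : ∀ s, MeasurableSet s → 𝒢.potentialLaw.map (fun β => 𝒢.pinGamma β i) s =
      C * gammaMeasure (1 / 2) 1 s := by
    intro s hs
    have h1 := 𝒢.lintegral_potentialLaw_vertex i (fun z => s.indicator 1 z.2)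
      ((measurable_one.indicator hs).comp measurable_snd)
    simp only [lintegral_indicator_one hs] at h1
    rw [Measure.map_apply hm hs,
      ← lintegral_indicator_one (hs.preimage hm)]
    rw [lintegral_mul_const' _ _ (measure_ne_top _ _)] at h1
    exact h1
  have hC1 : C = 1 := by
    have h1 := h Set.univ MeasurableSet.univ
    rwa [Measure.map_apply hm MeasurableSet.univ,
      Set.preimage_univ, measure_univ, measure_univ, mul_one, eq_comm] at h1
  ext s hs
  rw [h s hs, hC1, one_mul]

end H22.WeightedGraph
end

noncomputable section

open Matrix Filter Topology

namespace H22.WeightedGraph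

variable {V : Type*} [Fintype V] [DecidableEq V] (𝒢 : WeightedGraph V)

/-! ### First moments of `G η` -/

section FirstMoment

variable (η : V → ℝ) (k : V)

/-- The difference quotient, in the coordinate `k` of `η`, of the function
`η ↦ - exp (- ⟨η, G η⟩ / 2)`. -/
def expDiffQuot (s : ℝ) (β : V → ℝ) : ℝ :=
  s⁻¹ * (Real.exp (-(η ⬝ᵥ (𝒢.green β *ᵥ η)) / 2) -
    Real.exp (-((η + Pi.single k s) ⬝ᵥ (𝒢.green β *ᵥ (η + Pi.single k s))) / 2))

lemma green_quadratic_add_single (β : V → ℝ) (s : ℝ) :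
    (η + Pi.single k s) ⬝ᵥ (𝒢.green β *ᵥ (η + Pi.single k s)) =
      η ⬝ᵥ (𝒢.green β *ᵥ η) + (2 * s * (𝒢.green β *ᵥ η) k + s ^ 2 * 𝒢.green β k k) := by
  rw [mulVec_add, add_dotProduct, dotProduct_add, dotProduct_add,
    green_quadratic_comm _ _ η (Pi.single k s)]
  simp only [single_dotProduct, mulVec_single, op_smul_eq_smul, Pi.smul_apply,
    smul_eq_mul, col_apply]
  ring

lemma measurable_expDiffQuot (s : ℝ) : Measurable (𝒢.expDiffQuot η k s) :=
  ((𝒢.measurable_exp_green_quadratic η).sub (𝒢.measurable_exp_green_quadratic _)).const_mul _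

lemma tendsto_expDiffQuot (β : V → ℝ) :
    Tendsto (fun n : ℕ => 𝒢.expDiffQuot η k (1 / ((n : ℝ) + 1)) β) atTop
      (𝓝 ((𝒢.green β *ᵥ η) k * Real.exp (-(η ⬝ᵥ (𝒢.green β *ᵥ η)) / 2))) := by
  have hd : HasDerivAt (fun s : ℝ => -Real.exp (-((η + Pi.single k s) ⬝ᵥ
      (𝒢.green β *ᵥ (η + Pi.single k s))) / 2))
      ((𝒢.green β *ᵥ η) k * Real.exp (-(η ⬝ᵥ (𝒢.green β *ᵥ η)) / 2)) 0 := by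
    simp only [green_quadratic_add_single]
    have h1 : HasDerivAt (fun s : ℝ => -(η ⬝ᵥ (𝒢.green β *ᵥ η) +
        (2 * s * (𝒢.green β *ᵥ η) k + s ^ 2 * 𝒢.green β k k)) / 2)
        (-(𝒢.green β *ᵥ η) k) 0 := by
      have := (((((hasDerivAt_id (0 : ℝ)).const_mul 2).mul_const ((𝒢.green β *ᵥ η) k)).add
        ((hasDerivAt_pow 2 (0 : ℝ)).mul_const (𝒢.green β k k))).const_add
          (η ⬝ᵥ (𝒢.green β *ᵥ η))).neg.div_const 2
      refine this.congr_deriv ?_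
      simp
      ring
    refine h1.exp.neg.congr_deriv ?_
    simp
    ring
  have hs : Tendsto (fun n : ℕ => 1 / ((n : ℝ) + 1)) atTop (𝓝[≠] 0) :=
    tendsto_nhdsWithin_iff.2 ⟨tendsto_one_div_add_atTop_nhds_zero_nat,
      Eventually.of_forall fun n => (Nat.one_div_pos_of_nat).ne'⟩
  refine (hd.tendsto_slope_zero.comp hs).congr fun n => ?_
  simp only [Function.comp, expDiffQuot, zero_add, smul_eq_mul, Pi.single_zero, add_zero]
  ring

omit [Fintype V] in
variable {η k} in
lemma add_single_nonneg (hη : ∀ j, 0 ≤ η j) {s : ℝ} (hs : 0 ≤ s) (j : V) :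
    0 ≤ (η + Pi.single k s : V → ℝ) j := by
  refine add_nonneg (hη j) ?_
  by_cases h : j = k
  · subst h; simpa using hs
  · simp [h]

variable {η k} in
lemma integrable_expDiffQuot (hη : ∀ j, 0 ≤ η j) {s : ℝ} (hs : 0 ≤ s) :
    Integrable (𝒢.expDiffQuot η k s) 𝒢.potentialLaw :=
  ((𝒢.integrable_exp_green_quadratic hη).sub
    (𝒢.integrable_exp_green_quadratic (add_single_nonneg hη hs))).const_mul _

variable {η k} in
lemma integral_expDiffQuot (hη : ∀ j, 0 ≤ η j) {s : ℝ} (hs : 0 ≤ s) :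
    ∫ β, 𝒢.expDiffQuot η k s β ∂𝒢.potentialLaw =
      Real.exp (-∑ j, η j) * (s⁻¹ * (1 - Real.exp (-s))) := by
  have hη' := add_single_nonneg (k := k) hη hs
  simp only [expDiffQuot]
  rw [integral_const_mul, integral_sub (𝒢.integrable_exp_green_quadratic hη)
    (𝒢.integrable_exp_green_quadratic hη'), integral_exp_green_quadratic _ hη,
    integral_exp_green_quadratic _ hη']
  simp only [Pi.add_apply, Finset.sum_add_distrib, Finset.sum_pi_single', Finset.mem_univ, if_true,
    neg_add, Real.exp_add]
  ring

variable {η k} in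
lemma expDiffQuot_nonneg (hη : ∀ j, 0 ≤ η j) {s : ℝ} (hs : 0 ≤ s) {β : V → ℝ}
    (hβ : (𝒢.schrodinger β).PosDef) : 0 ≤ 𝒢.expDiffQuot η k s β := by
  refine mul_nonneg (inv_nonneg.2 hs) (sub_nonneg.2 (Real.exp_le_exp.2 ?_))
  rw [green_quadratic_add_single]
  have h1 := green_mulVec_nonneg hβ hη k
  have h2 := green_nonneg hβ k k
  have : 0 ≤ 2 * s * (𝒢.green β *ᵥ η) k + s ^ 2 * 𝒢.green β k k := by positivity
  linarith

variable {η k} in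
/-- The first moment of `(G η) k` under the tilted potential law is at most one. -/
lemma lintegral_green_mulVec_le (hη : ∀ j, 0 ≤ η j) :
    ∫⁻ β, ENNReal.ofReal ((𝒢.green β *ᵥ η) k * Real.exp (-(η ⬝ᵥ (𝒢.green β *ᵥ η)) / 2))
      ∂𝒢.potentialLaw ≤ ENNReal.ofReal (Real.exp (-∑ j, η j)) := by
  have hlim : ∀ β, ENNReal.ofReal
      ((𝒢.green β *ᵥ η) k * Real.exp (-(η ⬝ᵥ (𝒢.green β *ᵥ η)) / 2)) =
      liminf (fun n : ℕ => ENNReal.ofReal (𝒢.expDiffQuot η k (1 / ((n : ℝ) + 1)) β)) atTop :=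
    fun β => ((ENNReal.continuous_ofReal.tendsto _).comp
      (𝒢.tendsto_expDiffQuot η k β)).liminf_eq.symm
  simp only [hlim]
  -- Fatou's lemma needs no domination, so `η k = 0` is allowed; this matters for link vectors,
  -- which may have zero entries.
  refine (lintegral_liminf_le fun n => (𝒢.measurable_expDiffQuot η k _).ennreal_ofReal).trans ?_
  refine liminf_le_of_frequently_le' (Frequently.of_forall fun n => ?_)
  have hs : (0 : ℝ) < 1 / ((n : ℝ) + 1) := Nat.one_div_pos_of_nat
  rw [← ofReal_integral_eq_lintegral_ofReal (𝒢.integrable_expDiffQuot hη hs.le)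
    (𝒢.ae_posDef.mono fun β hβ => 𝒢.expDiffQuot_nonneg hη hs.le hβ)]
  refine ENNReal.ofReal_le_ofReal ?_
  have h1 := 𝒢.integral_expDiffQuot (k := k) hη hs.le
  refine h1.trans_le (mul_le_of_le_one_right (Real.exp_pos _).le ?_)
  rw [inv_mul_le_one₀ hs]
  linarith [Real.one_sub_le_exp_neg (1 / ((n : ℝ) + 1))]

variable {η} in
lemma green_mulVec_mul_le (hη : ∀ j, 0 ≤ η j) {β : V → ℝ} (hβ : (𝒢.schrodinger β).PosDef) :
    η k * (𝒢.green β *ᵥ η) k ≤ η ⬝ᵥ (𝒢.green β *ᵥ η) :=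
  Finset.single_le_sum (f := fun j => η j * (𝒢.green β *ᵥ η) j)
    (fun j _ => mul_nonneg (hη j) (green_mulVec_nonneg hβ hη j)) (Finset.mem_univ k)

variable {η} in
lemma green_diag_mul_le (hη : ∀ j, 0 ≤ η j) {β : V → ℝ} (hβ : (𝒢.schrodinger β).PosDef) :
    𝒢.green β k k * η k ≤ (𝒢.green β *ᵥ η) k :=
  Finset.single_le_sum (f := fun j => 𝒢.green β k j * η j)
    (fun j _ => mul_nonneg (green_nonneg hβ k j) (hη j)) (Finset.mem_univ k)

lemma mul_exp_neg_half_le (x : ℝ) : x * Real.exp (-x / 2) ≤ 2 := by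
  have h1 := Real.add_one_le_exp (x / 2)
  have h2 : Real.exp (x / 2) * Real.exp (-x / 2) = 1 := by rw [← Real.exp_add]; simp; ring
  have h3 := Real.exp_pos (-x / 2)
  nlinarith

variable {η k} in
-- A bound uniform in `β` and `s`, for dominated convergence: when `η k > 0`, both `(Gη) k` and
-- `G(k, k)` are at most multiples of `Q = ⟨η, Gη⟩`, and `Q exp(-Q / 2) ≤ 2`.
lemma expDiffQuot_le (hη : ∀ j, 0 ≤ η j) (hk : 0 < η k) {s : ℝ} (hs : 0 < s) (hs1 : s ≤ 1)
    {β : V → ℝ} (hβ : (𝒢.schrodinger β).PosDef) :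
    𝒢.expDiffQuot η k s β ≤ 2 * (1 / η k + 1 / (2 * η k ^ 2)) := by
  set Q := η ⬝ᵥ (𝒢.green β *ᵥ η) with hQ
  set x := (𝒢.green β *ᵥ η) k with hx
  set y := 𝒢.green β k k with hy
  have h1 : η k * x ≤ Q := 𝒢.green_mulVec_mul_le k hη hβ
  have h2 : y * η k ≤ x := 𝒢.green_diag_mul_le k hη hβ
  have hy0 : 0 ≤ y := green_nonneg hβ k k
  have hx' : x ≤ Q / η k := by rw [le_div_iff₀ hk]; linarith
  have hy' : y ≤ Q / η k ^ 2 := by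
    rw [le_div_iff₀ (by positivity)]
    nlinarith
  have h3 : 1 - Real.exp (-(2 * s * x + s ^ 2 * y) / 2) ≤ (2 * s * x + s ^ 2 * y) / 2 := by
    have := Real.one_sub_le_exp_neg ((2 * s * x + s ^ 2 * y) / 2)
    rw [neg_div]
    linarith
  have h4 : Real.exp (-(Q + (2 * s * x + s ^ 2 * y)) / 2) =
      Real.exp (-Q / 2) * Real.exp (-(2 * s * x + s ^ 2 * y) / 2) := by
    rw [← Real.exp_add]; congr 1; ring
  rw [expDiffQuot, green_quadratic_add_single, ← hQ, ← hx, ← hy, h4]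
  have he := Real.exp_pos (-Q / 2)
  calc s⁻¹ * (Real.exp (-Q / 2) - Real.exp (-Q / 2) * Real.exp (-(2 * s * x + s ^ 2 * y) / 2))
      = s⁻¹ * Real.exp (-Q / 2) * (1 - Real.exp (-(2 * s * x + s ^ 2 * y) / 2)) := by ring
    _ ≤ s⁻¹ * Real.exp (-Q / 2) * ((2 * s * x + s ^ 2 * y) / 2) := by gcongr
    _ = Real.exp (-Q / 2) * (x + s * y / 2) := by field_simp
    _ ≤ Real.exp (-Q / 2) * (Q / η k + Q / η k ^ 2 / 2) := by
        gcongr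
        nlinarith
    _ = (Q * Real.exp (-Q / 2)) * (1 / η k + 1 / (2 * η k ^ 2)) := by field_simp
    _ ≤ 2 * (1 / η k + 1 / (2 * η k ^ 2)) := by
        gcongr
        exact mul_exp_neg_half_le Q

variable {η k} in
/-- The first moment of `(G η) k` under the tilted potential law. -/
lemma integral_green_mulVec (hη : ∀ j, 0 ≤ η j) (hk : 0 < η k) :
    ∫ β, (𝒢.green β *ᵥ η) k * Real.exp (-(η ⬝ᵥ (𝒢.green β *ᵥ η)) / 2) ∂𝒢.potentialLaw =
      Real.exp (-∑ j, η j) := by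
  have hpos : ∀ n : ℕ, (0 : ℝ) < 1 / ((n : ℝ) + 1) := fun n => Nat.one_div_pos_of_nat
  have h1 : Tendsto (fun n : ℕ => ∫ β, 𝒢.expDiffQuot η k (1 / ((n : ℝ) + 1)) β ∂𝒢.potentialLaw)
      atTop (𝓝 (∫ β, (𝒢.green β *ᵥ η) k * Real.exp (-(η ⬝ᵥ (𝒢.green β *ᵥ η)) / 2)
        ∂𝒢.potentialLaw)) := by
    refine tendsto_integral_of_dominated_convergence
      (fun _ => 2 * (1 / η k + 1 / (2 * η k ^ 2)))
      (fun n => (𝒢.measurable_expDiffQuot η k _).aestronglyMeasurable) (integrable_const _)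
      (fun n => ?_) (Eventually.of_forall fun β => 𝒢.tendsto_expDiffQuot η k β)
    filter_upwards [𝒢.ae_posDef] with β hβ
    rw [Real.norm_of_nonneg (𝒢.expDiffQuot_nonneg hη (hpos n).le hβ)]
    refine 𝒢.expDiffQuot_le hη hk (hpos n) ?_ hβ
    rw [div_le_one (by positivity)]
    linarith [Nat.cast_nonneg (α := ℝ) n]
  have h2 : Tendsto (fun n : ℕ => ∫ β, 𝒢.expDiffQuot η k (1 / ((n : ℝ) + 1)) β ∂𝒢.potentialLaw)
      atTop (𝓝 (Real.exp (-∑ j, η j))) := by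
    simp only [𝒢.integral_expDiffQuot hη (hpos _).le]
    have hd : HasDerivAt (fun s : ℝ => -Real.exp (-s)) 1 0 := by
      refine (hasDerivAt_neg (0 : ℝ)).exp.neg.congr_deriv ?_
      simp
    have hs : Tendsto (fun n : ℕ => 1 / ((n : ℝ) + 1)) atTop (𝓝[≠] 0) :=
      tendsto_nhdsWithin_iff.2 ⟨tendsto_one_div_add_atTop_nhds_zero_nat,
        Eventually.of_forall fun n => (hpos n).ne'⟩
    have h3 := (hd.tendsto_slope_zero.comp hs).const_mul (Real.exp (-∑ j, η j))
    rw [mul_one] at h3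
    refine h3.congr fun n => ?_
    simp only [Function.comp, zero_add, smul_eq_mul, neg_zero, Real.exp_zero]
    ring
  exact tendsto_nhds_unique h1 h2

variable {η k} in
lemma integrable_green_mulVec (hη : ∀ j, 0 ≤ η j) :
    Integrable (fun β => (𝒢.green β *ᵥ η) k * Real.exp (-(η ⬝ᵥ (𝒢.green β *ᵥ η)) / 2))
      𝒢.potentialLaw := by
  refine ⟨((𝒢.measurable_green_mulVec measurable_id η k).mul
    (𝒢.measurable_exp_green_quadratic η)).aestronglyMeasurable, ?_⟩
  rw [hasFiniteIntegral_iff_ofReal]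
  · exact (𝒢.lintegral_green_mulVec_le hη).trans_lt ENNReal.ofReal_lt_top
  · filter_upwards [𝒢.ae_posDef] with β hβ
    exact mul_nonneg (green_mulVec_nonneg hβ hη k) (Real.exp_pos _).le

end FirstMoment

end H22.WeightedGraph
end

noncomputable section

open Matrix Filter Topology

namespace H22.WeightedGraph

variable {V : Type*} [Fintype V] [DecidableEq V] (𝒢 : WeightedGraph V)

/-! ### Row sums of the Green matrix -/

/-- The sum of the row `k` of the Green matrix. -/
def greenRow (β : V → ℝ) (k : V) : ℝ := (𝒢.green β *ᵥ fun _ => 1) k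

/-- The sum of all the entries of the Green matrix. -/
def greenMass (β : V → ℝ) : ℝ := ∑ k, 𝒢.greenRow β k

lemma measurable_greenRow (k : V) : Measurable fun β => 𝒢.greenRow β k :=
  𝒢.measurable_green_mulVec measurable_id _ k

lemma measurable_greenMass : Measurable 𝒢.greenMass :=
  Finset.measurable_sum _ fun k _ => 𝒢.measurable_greenRow k

variable {𝒢} in
lemma greenRow_nonneg {β : V → ℝ} (h : (𝒢.schrodinger β).PosDef) (k : V) : 0 ≤ 𝒢.greenRow β k :=
  green_mulVec_nonneg h (fun _ => zero_le_one) k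

variable {𝒢} in
lemma greenMass_nonneg {β : V → ℝ} (h : (𝒢.schrodinger β).PosDef) : 0 ≤ 𝒢.greenMass β :=
  Finset.sum_nonneg fun k _ => greenRow_nonneg h k

lemma green_quadratic_const (β : V → ℝ) (t : ℝ) :
    (fun _ => t) ⬝ᵥ (𝒢.green β *ᵥ fun _ => t) = t ^ 2 * 𝒢.greenMass β := by
  have h : (fun _ => t : V → ℝ) = t • fun _ => 1 := by ext; simp
  rw [h, mulVec_smul, dotProduct_smul, smul_dotProduct, greenMass]
  simp only [dotProduct, greenRow, smul_eq_mul, one_mul]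
  ring

lemma greenRow_const (β : V → ℝ) (t : ℝ) (k : V) :
    (𝒢.green β *ᵥ fun _ => t) k = t * 𝒢.greenRow β k := by
  have h : (fun _ => t : V → ℝ) = t • fun _ => 1 := by ext; simp
  rw [h, mulVec_smul]
  rfl

lemma integrable_greenRow_exp {t : ℝ} (ht : 0 < t) (k : V) :
    Integrable (fun β => 𝒢.greenRow β k * Real.exp (-(t ^ 2 * 𝒢.greenMass β) / 2))
      𝒢.potentialLaw := by
  have h := (𝒢.integrable_green_mulVec (η := fun _ => t) (k := k) fun _ => ht.le).const_mul t⁻¹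
  simp only [green_quadratic_const, greenRow_const] at h
  refine h.congr (Eventually.of_forall fun β => ?_)
  simp only
  field_simp

/-- The first moment at the constant vector `η = t`. That the right-hand side does not involve `k`
is the source of the equality of conditional expectations. -/
lemma integral_greenRow_exp {t : ℝ} (ht : 0 < t) (k : V) :
    ∫ β, 𝒢.greenRow β k * Real.exp (-(t ^ 2 * 𝒢.greenMass β) / 2) ∂𝒢.potentialLaw =
      t⁻¹ * Real.exp (-(Fintype.card V * t)) := by
  have h := 𝒢.integral_green_mulVec (η := fun _ => t) (k := k) (fun _ => ht.le) ht
  simp only [green_quadratic_const, greenRow_const, mul_assoc, integral_const_mul,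
    Finset.sum_const, Finset.card_univ, nsmul_eq_mul] at h
  rw [← h, inv_mul_cancel_left₀ ht.ne']

/-- The potential law weighted by the sum of the row `k` of the Green matrix, tilted so as to be
finite. -/
def rowLaw (k : V) : Measure (V → ℝ) :=
  𝒢.potentialLaw.withDensity fun β =>
    ENNReal.ofReal (𝒢.greenRow β k * Real.exp (-𝒢.greenMass β / 2))

lemma measurable_greenRow_mul_exp (k : V) :
    Measurable fun β => 𝒢.greenRow β k * Real.exp (-𝒢.greenMass β / 2) :=
  (𝒢.measurable_greenRow k).mul (𝒢.measurable_greenMass.neg.div_const 2).exp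

lemma rowLaw_univ (k : V) :
    𝒢.rowLaw k Set.univ = ENNReal.ofReal (Real.exp (-Fintype.card V)) := by
  have h1 := 𝒢.integral_greenRow_exp one_pos k
  have h2 := 𝒢.integrable_greenRow_exp one_pos k
  simp only [one_pow, one_mul, inv_one, mul_one] at h1 h2
  rw [rowLaw, withDensity_apply _ MeasurableSet.univ, Measure.restrict_univ,
    ← ofReal_integral_eq_lintegral_ofReal h2, h1]
  filter_upwards [𝒢.ae_posDef] with β hβ
  exact mul_nonneg (greenRow_nonneg hβ k) (Real.exp_pos _).le

instance (k : V) : IsFiniteMeasure (𝒢.rowLaw k) :=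
  ⟨by rw [rowLaw_univ]; exact ENNReal.ofReal_lt_top⟩

lemma rowLaw_ne_zero (k : V) : 𝒢.rowLaw k ≠ 0 := fun h => by
  have := 𝒢.rowLaw_univ k
  rw [h, Measure.coe_zero, Pi.zero_apply, eq_comm, ENNReal.ofReal_eq_zero] at this
  exact absurd (Real.exp_pos _) (not_lt.2 this)

lemma rowLaw_density_ae (k : V) (s : ℝ) :
    (fun β => Real.exp (s * 𝒢.greenMass β) *
      (ENNReal.ofReal (𝒢.greenRow β k * Real.exp (-𝒢.greenMass β / 2))).toReal)
      =ᵐ[𝒢.potentialLaw] fun β =>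
        𝒢.greenRow β k * Real.exp (-((1 - 2 * s) * 𝒢.greenMass β) / 2) := by
  filter_upwards [𝒢.ae_posDef] with β hβ
  rw [ENNReal.toReal_ofReal (mul_nonneg (greenRow_nonneg hβ k) (Real.exp_pos _).le),
    mul_left_comm, ← Real.exp_add]
  congr 2
  ring

lemma integrable_rowLaw_iff (k : V) (s : ℝ) :
    Integrable (fun β => Real.exp (s * 𝒢.greenMass β)) (𝒢.rowLaw k) ↔
      Integrable (fun β => 𝒢.greenRow β k * Real.exp (-((1 - 2 * s) * 𝒢.greenMass β) / 2))
        𝒢.potentialLaw := by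
  rw [rowLaw, integrable_withDensity_iff (𝒢.measurable_greenRow_mul_exp k).ennreal_ofReal
    (Eventually.of_forall fun _ => ENNReal.ofReal_lt_top)]
  exact integrable_congr (𝒢.rowLaw_density_ae k s)

lemma mgf_rowLaw (k : V) (s : ℝ) :
    mgf 𝒢.greenMass (𝒢.rowLaw k) s =
      ∫ β, 𝒢.greenRow β k * Real.exp (-((1 - 2 * s) * 𝒢.greenMass β) / 2) ∂𝒢.potentialLaw := by
  rw [mgf, rowLaw, integral_withDensity_eq_integral_toReal_smul
    (𝒢.measurable_greenRow_mul_exp k).ennreal_ofReal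
    (Eventually.of_forall fun _ => ENNReal.ofReal_lt_top)]
  refine integral_congr_ae (EventuallyEq.trans (Eventually.of_forall fun β => ?_)
    (𝒢.rowLaw_density_ae k s))
  simp only [smul_eq_mul]
  ring

/-- The integral would dominate `t⁻¹ exp(-|V| t)` for every `t > 0`, which is unbounded as `t → 0`.
Hence the moment generating functions of all row laws diverge at the same arguments. -/
lemma not_integrable_greenRow_exp (k : V) {s : ℝ} (hs : s ≤ 0) :
    ¬ Integrable (fun β => 𝒢.greenRow β k * Real.exp (-(s * 𝒢.greenMass β) / 2))
      𝒢.potentialLaw := by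
  intro hint
  set I := ∫ β, 𝒢.greenRow β k * Real.exp (-(s * 𝒢.greenMass β) / 2) ∂𝒢.potentialLaw with hI
  have hle : ∀ t : ℝ, 0 < t → t⁻¹ * Real.exp (-(Fintype.card V * t)) ≤ I := by
    intro t ht
    rw [← 𝒢.integral_greenRow_exp ht k]
    refine integral_mono_ae (𝒢.integrable_greenRow_exp ht k) hint ?_
    filter_upwards [𝒢.ae_posDef] with β hβ
    have h1 := greenRow_nonneg hβ k
    have h2 := greenMass_nonneg hβ
    refine mul_le_mul_of_nonneg_left (Real.exp_le_exp.2 ?_) h1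
    have h3 : s * 𝒢.greenMass β ≤ 0 := mul_nonpos_of_nonpos_of_nonneg hs h2
    have h4 : 0 ≤ t ^ 2 * 𝒢.greenMass β := by positivity
    linarith
  have hlim : Tendsto (fun t : ℝ => t⁻¹ * Real.exp (-(Fintype.card V * t))) (𝓝[>] 0) atTop := by
    refine tendsto_inv_nhdsGT_zero.atTop_mul_pos (C := Real.exp (-(Fintype.card V * 0)))
      (Real.exp_pos _) ?_
    exact (Continuous.tendsto (by fun_prop) 0).mono_left nhdsWithin_le_nhds
  obtain ⟨t, ht, ht0⟩ := ((hlim.eventually_gt_atTop I).and self_mem_nhdsWithin).exists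
  exact absurd (hle t ht0) (not_le.2 ht)

/-- For `s < 1/2` both sides are the explicit value at `t = √(1 - 2s)`; for `s ≥ 1/2` both integrals
diverge and take the default value zero. -/
lemma mgf_rowLaw_eq (k l : V) :
    mgf 𝒢.greenMass (𝒢.rowLaw k) = mgf 𝒢.greenMass (𝒢.rowLaw l) := by
  ext s
  rw [mgf_rowLaw, mgf_rowLaw]
  rcases le_or_gt (1 - 2 * s) 0 with hs | hs
  · rw [integral_undef (𝒢.not_integrable_greenRow_exp k hs),
      integral_undef (𝒢.not_integrable_greenRow_exp l hs)]
  · rw [← Real.sq_sqrt hs.le, integral_greenRow_exp _ (Real.sqrt_pos.2 hs),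
      integral_greenRow_exp _ (Real.sqrt_pos.2 hs)]

lemma zero_mem_interior_integrableExpSet (k : V) :
    (0 : ℝ) ∈ interior (integrableExpSet 𝒢.greenMass (𝒢.rowLaw k)) := by
  refine mem_interior_iff_mem_nhds.2 (mem_of_superset (Iio_mem_nhds (show (0 : ℝ) < 1 / 2 by
    norm_num)) fun s hs => ?_)
  have hs' : 0 < 1 - 2 * s := by
    have : s < 1 / 2 := hs
    linarith
  refine (𝒢.integrable_rowLaw_iff k s).2 ?_
  have := 𝒢.integrable_greenRow_exp (Real.sqrt_pos.2 hs') k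
  rwa [Real.sq_sqrt hs'.le] at this

/-- The tilt in `rowLaw` makes the moment generating function finite around zero; analytic
continuation then passes from its equality to that of the characteristic functions. -/
lemma map_greenMass_rowLaw (k l : V) :
    (𝒢.rowLaw k).map 𝒢.greenMass = (𝒢.rowLaw l).map 𝒢.greenMass := by
  refine Measure.ext_of_charFun (funext fun t => ?_)
  rw [← complexMGF_mul_I 𝒢.measurable_greenMass.aemeasurable,
    ← complexMGF_mul_I 𝒢.measurable_greenMass.aemeasurable]
  refine eqOn_complexMGF_of_mgf' (𝒢.mgf_rowLaw_eq k l)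
    (by simp [rowLaw_ne_zero]) ?_
  simpa using 𝒢.zero_mem_interior_integrableExpSet k

/-- Given the sum of all the entries of the Green matrix, all its row sums have the same conditional
expectation. -/
theorem lintegral_greenRow_eq (k l : V) {Ψ : ℝ → ENNReal} (hΨ : Measurable Ψ) :
    ∫⁻ β, ENNReal.ofReal (𝒢.greenRow β k) * Ψ (𝒢.greenMass β) ∂𝒢.potentialLaw =
      ∫⁻ β, ENNReal.ofReal (𝒢.greenRow β l) * Ψ (𝒢.greenMass β) ∂𝒢.potentialLaw := by
  -- The factor `exp(x / 2)` undoes the tilt in `rowLaw`.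
  have hΦ : Measurable fun x : ℝ => ENNReal.ofReal (Real.exp (x / 2)) * Ψ x := by fun_prop
  have key : ∀ j, ∫⁻ β, ENNReal.ofReal (𝒢.greenRow β j) * Ψ (𝒢.greenMass β) ∂𝒢.potentialLaw =
      ∫⁻ x, ENNReal.ofReal (Real.exp (x / 2)) * Ψ x ∂(𝒢.rowLaw j).map 𝒢.greenMass := by
    intro j
    rw [lintegral_map hΦ 𝒢.measurable_greenMass, rowLaw]
    refine Eq.trans (lintegral_congr_ae ?_) (lintegral_withDensity_eq_lintegral_mul _
      (𝒢.measurable_greenRow_mul_exp j).ennreal_ofReal (hΦ.comp 𝒢.measurable_greenMass)).symm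
    filter_upwards [𝒢.ae_posDef] with β hβ
    simp only [Pi.mul_apply, Function.comp]
    rw [← mul_assoc, ← ENNReal.ofReal_mul
      (mul_nonneg (greenRow_nonneg hβ j) (Real.exp_pos _).le), mul_assoc, ← Real.exp_add]
    simp [neg_div]
  rw [key k, key l, 𝒢.map_greenMass_rowLaw k l]

end H22.WeightedGraph
end

/-! ### The column at the pinning vertex as a Dirichlet solution, and the reduced graph. -/

noncomputable section

open Matrix

namespace H22.WeightedGraph

section Pinned

variable {V : Type*} [Fintype V] [DecidableEq V] (𝒢 : WeightedGraph V)

/-- The column `i` of the inverse of the matrix obtained from `H_β` on replacing the row `i` by the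
one of the identity matrix: the solution of the Dirichlet problem equal to one at `i`. -/
def pinnedColumn (β : V → ℝ) (i k : V) : ℝ :=
  ((𝒢.schrodinger β).updateRow i (Pi.single i 1))⁻¹ k i

/-- The value `β i` enters `H_β` only through the replaced row. This gives measurability with
respect to `𝓕'`, whose generators omit `β'` at the pinning vertex. -/
lemma pinnedColumn_update (β : V → ℝ) (i k : V) (t : ℝ) :
    𝒢.pinnedColumn (Function.update β i t) i k = 𝒢.pinnedColumn β i k := by
  have h : (𝒢.schrodinger (Function.update β i t)).updateRow i (Pi.single i 1) =
      (𝒢.schrodinger β).updateRow i (Pi.single i 1) := by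
    ext a b
    by_cases ha : a = i
    · subst ha; simp
    · simp [updateRow_ne ha, schrodinger, diagonal_apply, Function.update_of_ne ha]
  rw [pinnedColumn, pinnedColumn, h]

lemma measurable_pinnedColumn {α : Type*} [MeasurableSpace α] {β : α → V → ℝ} {i : V}
    (hβ : ∀ k, k ≠ i → Measurable fun x => β x k) (k : V) :
    Measurable fun x => 𝒢.pinnedColumn (β x) i k := by
  have h : Measurable fun x => Function.update (β x) i 0 := by
    refine measurable_pi_lambda _ fun k => ?_
    by_cases hk : k = i
    · subst hk; simp
    · simpa [Function.update_of_ne hk] using hβ k hk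
  have hup : (fun x => 𝒢.pinnedColumn (β x) i k) =
      fun x => 𝒢.pinnedColumn (Function.update (β x) i 0) i k :=
    funext fun x => (𝒢.pinnedColumn_update _ i k 0).symm
  rw [hup]
  refine measurable_inv_apply (fun a b => ?_) k i
  by_cases ha : a = i
  · subst ha; simp
  · simpa [updateRow_ne ha] using 𝒢.measurable_schrodinger_apply h a b

/-- A kernel vector of the modified matrix vanishes at `i` and is a multiple of column `i` of `G`,
so it is zero as `G(i, i) ≠ 0`. Only invertibility of `H` is assumed, as that is what is established
for the reduced operator. -/
lemma pinnedColumn_eq {β : V → ℝ} {i : V} (h : IsUnit (𝒢.schrodinger β))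
    (hi : 𝒢.green β i i ≠ 0) (k : V) :
    𝒢.pinnedColumn β i k = 𝒢.green β k i / 𝒢.green β i i := by
  have hdet := (isUnit_iff_isUnit_det _).1 h
  set M := (𝒢.schrodinger β).updateRow i (Pi.single i 1) with hM
  have hMi : ∀ x : V → ℝ, (M *ᵥ x) i = x i := fun x => by simp [hM, mulVec]
  have hMk : ∀ (x : V → ℝ) (k : V), k ≠ i → (M *ᵥ x) k = (𝒢.schrodinger β *ᵥ x) k :=
    fun x k hk => by simp [hM, mulVec, updateRow_ne hk]
  have hcol : 𝒢.schrodinger β *ᵥ (fun k => 𝒢.green β k i) = Pi.single i 1 := by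
    have : (fun k => 𝒢.green β k i) = 𝒢.green β *ᵥ Pi.single i 1 := by
      rw [mulVec_single_one]; rfl
    rw [this, green, mulVec_mulVec, mul_nonsing_inv _ hdet, one_mulVec]
  have hunit : IsUnit M := by
    refine mulVec_injective_iff_isUnit.1 ((injective_iff_map_eq_zero M.mulVecLin).2 fun x hx => ?_)
    have hx' : M *ᵥ x = 0 := hx
    have hxi : x i = 0 := by rw [← hMi x, hx']; rfl
    have h1 : 𝒢.schrodinger β *ᵥ x = Pi.single i ((𝒢.schrodinger β *ᵥ x) i) := by
      ext k
      by_cases hk : k = i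
      · subst hk; simp
      · rw [← hMk x k hk, hx']; simp [hk]
    have h2 : x = 𝒢.green β *ᵥ Pi.single i ((𝒢.schrodinger β *ᵥ x) i) := by
      rw [← h1, green, mulVec_mulVec, nonsing_inv_mul _ hdet, one_mulVec]
    have h3 := congrFun h2 i
    rw [hxi, mulVec_single] at h3
    have h4 : (𝒢.schrodinger β *ᵥ x) i = 0 := by
      simpa [hi] using h3.symm
    rw [h2, h4]; simp
  have hz : M *ᵥ (fun k => 𝒢.green β k i / 𝒢.green β i i) = Pi.single i 1 := by
    have hs : (fun k => 𝒢.green β k i / 𝒢.green β i i) =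
        (𝒢.green β i i)⁻¹ • fun k => 𝒢.green β k i := by
      ext k; simp [div_eq_inv_mul]
    ext k
    by_cases hk : k = i
    · subst hk; rw [hMi, div_self hi]; simp
    · rw [hMk _ k hk, hs, mulVec_smul, hcol]; simp [hk]
  have h5 : (fun k => 𝒢.green β k i / 𝒢.green β i i) = M⁻¹ *ᵥ Pi.single i 1 := by
    rw [← hz, mulVec_mulVec, nonsing_inv_mul _ ((isUnit_iff_isUnit_det _).1 hunit), one_mulVec]
  have h6 := congrFun h5 k
  rw [mulVec_single_one] at h6
  exact h6.symm

end Pinned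

/-! ### The reduced graph -/

section Reduced

variable {V : Type*} [Fintype V] [DecidableEq V] (𝒢 : WeightedGraph V) (U : Finset V)

/-- The sum of the entries of `(H_{U,U})⁻¹`. -/
def massOn (β : V → ℝ) : ℝ := (𝒢.comap (Subtype.val : U → V)).greenMass fun x => β x

omit [Fintype V] in
lemma sum_greenOn (β : V → ℝ) : ∑ i : U, ∑ j : U, 𝒢.greenOn U β i j = 𝒢.massOn U β := by
  rw [massOn, greenMass]
  refine Finset.sum_congr rfl fun i _ => ?_
  rw [greenRow, green, schrodinger_comap _ Subtype.val_injective, mulVec, dotProduct]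
  simp [greenOn]

/-- The reduced potential, in terms of the potential outside `U` and of the sum of the entries
of `(H_{U,U})⁻¹`. -/
def reducedOf (b : {x // x ∉ U} → ℝ) (g : ℝ) : ReducedVertex U → ℝ
  | some k => b k
  | none => 1 / (2 * (1 / (U.card : ℝ) ^ 2 * g))

/-- Thus `β'` sees the potential on `U` only through the total mass of `(H_{U,U})⁻¹`. -/
lemma reducedPotential_eq (β : V → ℝ) :
    𝒢.reducedPotential U β = reducedOf U (fun x => β x) (𝒢.massOn U β) := by
  ext (_ | k)
  · simp only [reducedPotential, reducedOf, sum_greenOn]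
  · rfl

omit [Fintype V] [DecidableEq V] in
lemma measurable_reducedOf :
    Measurable fun z : ({x // x ∉ U} → ℝ) × ℝ => reducedOf U z.1 z.2 := by
  refine measurable_pi_lambda _ fun k => ?_
  rcases k with _ | k
  · simp only [reducedOf]; fun_prop
  · exact (measurable_pi_apply k).comp measurable_fst

omit [Fintype V] in
omit [Fintype V] in
lemma measurable_massOn : Measurable (𝒢.massOn U) :=
  (measurable_greenMass _).comp (measurable_pi_lambda _ fun _ => measurable_pi_apply _)

lemma measurable_reducedPotential : Measurable (𝒢.reducedPotential U) := by
  have : 𝒢.reducedPotential U = fun β => reducedOf U (fun x => β x) (𝒢.massOn U β) :=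
    funext (𝒢.reducedPotential_eq U)
  rw [this]
  exact (measurable_reducedOf U).comp
    ((measurable_pi_lambda _ fun _ => measurable_pi_apply _).prodMk (𝒢.measurable_massOn U))

variable {𝒢} in
lemma greenMass_pos [Nonempty V] {β : V → ℝ} (h : (𝒢.schrodinger β).PosDef) :
    0 < 𝒢.greenMass β := by
  have h1 : (fun _ => 1 : V → ℝ) ≠ 0 := fun h => one_ne_zero (congrFun h (Classical.arbitrary V))
  have h2 := h.inv.dotProduct_mulVec_pos h1
  have h3 := 𝒢.green_quadratic_const β 1
  rw [one_pow, one_mul] at h3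
  rw [← h3]
  exact h2

variable {𝒢 U}

lemma massOn_pos (hU : U.Nonempty) {β : V → ℝ} (h : (𝒢.schrodinger β).PosDef) :
    0 < 𝒢.massOn U β := by
  have : Nonempty U := hU.to_subtype
  exact greenMass_pos (𝒢.posDef_comap (f := (Subtype.val : U → V)) Subtype.val_injective h)

variable (𝒢 U) in
/-- The extension to `V` of a vector on the reduced graph, equilibrated on `U`. -/
def liftVec (β : V → ℝ) (x : ReducedVertex U → ℝ) : V → ℝ := fun k =>
  if h : k ∈ U then (U.card : ℝ) / 𝒢.massOn U β * x none *
    (𝒢.comap (Subtype.val : U → V)).greenRow (fun y => β y) ⟨k, h⟩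
  else x (some ⟨k, h⟩)

omit [Fintype V] in
lemma liftVec_mem (β : V → ℝ) (x : ReducedVertex U → ℝ) (k : U) :
    𝒢.liftVec U β x k = (U.card : ℝ) / 𝒢.massOn U β * x none *
      (𝒢.comap (Subtype.val : U → V)).greenRow (fun y => β y) k := by
  simp [liftVec]

omit [Fintype V] in
lemma liftVec_notMem (β : V → ℝ) (x : ReducedVertex U → ℝ) (k : {x // x ∉ U}) :
    𝒢.liftVec U β x k = x (some k) := by
  simp [liftVec, k.2]

lemma sum_liftVec (hU : U.Nonempty) {β : V → ℝ} (h : (𝒢.schrodinger β).PosDef)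
    (x : ReducedVertex U → ℝ) : ∑ i : U, 𝒢.liftVec U β x i = U.card * x none := by
  simp only [liftVec_mem]
  rw [← Finset.mul_sum]
  have := (massOn_pos hU h).ne'
  change _ * 𝒢.massOn U β = _
  field_simp

lemma reduced_mulVec_some (β : V → ℝ) (x : ReducedVertex U → ℝ) (k : {x // x ∉ U}) :
    ((𝒢.reduced U).schrodinger (𝒢.reducedPotential U β) *ᵥ x) (some k) =
      2 * β k * x (some k) - ((∑ i : U, 𝒢.weight k i) * x none +
        ∑ l : {x // x ∉ U}, 𝒢.weight k l * x (some l)) := by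
  rw [schrodinger_mulVec_apply, Fintype.sum_option, Finset.sum_coe_sort U (fun i => 𝒢.weight k i)]
  rfl

lemma reduced_mulVec_none (β : V → ℝ) (x : ReducedVertex U → ℝ) :
    ((𝒢.reduced U).schrodinger (𝒢.reducedPotential U β) *ᵥ x) none =
      (U.card : ℝ) ^ 2 / 𝒢.massOn U β * x none -
        ∑ l : {x // x ∉ U}, (∑ i : U, 𝒢.weight l i) * x (some l) := by
  rw [schrodinger_mulVec_apply, Fintype.sum_option, reducedPotential_eq]
  have h0 : (𝒢.reduced U).weight none none = 0 := rfl
  have hs : ∀ l : {x // x ∉ U}, (𝒢.reduced U).weight none (some l) = ∑ i : U, 𝒢.weight l i :=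
    fun l => (Finset.sum_coe_sort U (fun i => 𝒢.weight l i)).symm
  have h1 : 2 * (1 / (2 * (1 / (U.card : ℝ) ^ 2 * 𝒢.massOn U β))) =
      (U.card : ℝ) ^ 2 / 𝒢.massOn U β := by
    rw [← mul_div_assoc, mul_one, div_mul_cancel_left₀ two_ne_zero, mul_inv, one_div, inv_inv,
      div_eq_mul_inv]
  simp only [h0, hs, reducedOf, zero_mul, zero_add, h1]

/-- The extension intertwines the Schrödinger operators of the graph and of the reduced graph. -/
lemma schrodinger_mulVec_liftVec (hU : U.Nonempty) (hind : 𝒢.Indistinguishable U) {β : V → ℝ}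
    (h : (𝒢.schrodinger β).PosDef) (x : ReducedVertex U → ℝ) (k : V) :
    (𝒢.schrodinger β *ᵥ 𝒢.liftVec U β x) k =
      if hk : k ∈ U then
        ((𝒢.reduced U).schrodinger (𝒢.reducedPotential U β) *ᵥ x) none / U.card
      else ((𝒢.reduced U).schrodinger (𝒢.reducedPotential U β) *ᵥ x) (some ⟨k, hk⟩) := by
  obtain ⟨u, hu⟩ := hU
  have hc : (U.card : ℝ) ≠ 0 := by exact_mod_cast (Finset.card_pos.2 ⟨u, hu⟩).ne'
  have hw : ∀ (l : {x // x ∉ U}) (i : U), 𝒢.weight l i = 𝒢.weight l u :=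
    fun l i => hind i i.2 u hu l l.2
  have hsum : ∀ l : {x // x ∉ U}, ∑ i : U, 𝒢.weight l i = U.card * 𝒢.weight l u := fun l => by
    simp [hw]
  rw [schrodinger_mulVec_apply, sum_split U]
  simp only [liftVec_notMem]
  by_cases hk : k ∈ U
  · rw [dif_pos hk, reduced_mulVec_none]
    have hpd := 𝒢.posDef_comap (f := (Subtype.val : U → V)) Subtype.val_injective h
    -- On `U` the lift is a multiple of `(H_{U,U})⁻¹ 1`, so `H_{U,U}` sends it to a constant; by
    -- indistinguishability the contribution from outside is constant too. The coefficient `|U| /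
    -- massOn` makes the total `1 / |U|` times the reduced row at `none`.
    have h1 := congrFun (schrodinger_mulVec_green hpd (fun _ => 1)) ⟨k, hk⟩
    rw [schrodinger_mulVec_apply] at h1
    change 2 * β k * (𝒢.comap (Subtype.val : U → V)).greenRow (fun y => β y) ⟨k, hk⟩ -
      ∑ l : U, 𝒢.weight k l * (𝒢.comap (Subtype.val : U → V)).greenRow (fun y => β y) l = 1 at h1
    have h2 := liftVec_mem (𝒢 := 𝒢) β x ⟨k, hk⟩
    simp only at h2
    rw [h2]
    simp only [liftVec_mem]
    have h3 : ∀ l : {x // x ∉ U}, 𝒢.weight k l = 𝒢.weight l u := fun l => by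
      rw [𝒢.symm]; exact hw l ⟨k, hk⟩
    simp only [h3, hsum]
    set A := (U.card : ℝ) / 𝒢.massOn U β * x none with hA
    have h4 : ∑ l : U, 𝒢.weight k l *
        (A * (𝒢.comap (Subtype.val : U → V)).greenRow (fun y => β y) l) =
        A * ∑ l : U, 𝒢.weight k l *
          (𝒢.comap (Subtype.val : U → V)).greenRow (fun y => β y) l := by
      rw [Finset.mul_sum]
      exact Finset.sum_congr rfl fun _ _ => by ring
    have h5 : ∑ l : {x // x ∉ U}, (U.card : ℝ) * 𝒢.weight l u * x (some l) =
        U.card * ∑ l : {x // x ∉ U}, 𝒢.weight l u * x (some l) := by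
      rw [Finset.mul_sum]
      exact Finset.sum_congr rfl fun _ _ => by ring
    have h6 : (U.card : ℝ) ^ 2 / 𝒢.massOn U β * x none = U.card * A := by rw [hA]; ring
    rw [h4, h5, h6, ← mul_sub, mul_div_cancel_left₀ _ hc]
    linear_combination A * h1
  · rw [dif_neg hk, reduced_mulVec_some]
    have h2 := liftVec_notMem (𝒢 := 𝒢) β x ⟨k, hk⟩
    simp only at h2
    -- A vertex outside `U` sees the lift on `U` only through its sum, which is `|U|` times `x
    -- none`.
    have h3 : ∑ i : U, 𝒢.weight k i * 𝒢.liftVec U β x i =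
        (∑ i : U, 𝒢.weight k i) * x none := by
      have h4 := fun i => hw ⟨k, hk⟩ i
      have h5 := hsum ⟨k, hk⟩
      simp only at h4 h5
      simp only [h4, ← Finset.mul_sum, sum_liftVec ⟨u, hu⟩ h]
      simp
      ring
    rw [h2, h3]

/-- The lift is injective and maps the kernel of `H'` into the kernel of `H`. -/
lemma isUnit_reduced_schrodinger (hU : U.Nonempty) (hind : 𝒢.Indistinguishable U) {β : V → ℝ}
    (h : (𝒢.schrodinger β).PosDef) :
    IsUnit ((𝒢.reduced U).schrodinger (𝒢.reducedPotential U β)) := by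
  refine mulVec_injective_iff_isUnit.1 ((injective_iff_map_eq_zero
    ((𝒢.reduced U).schrodinger (𝒢.reducedPotential U β)).mulVecLin).2 fun x hx => ?_)
  have hx' : (𝒢.reduced U).schrodinger (𝒢.reducedPotential U β) *ᵥ x = 0 := hx
  have h1 : 𝒢.schrodinger β *ᵥ 𝒢.liftVec U β x = 0 := by
    ext k
    rw [schrodinger_mulVec_liftVec hU hind h, hx']
    split_ifs <;> simp
  have h2 : 𝒢.liftVec U β x = 0 := by
    rw [← green_mulVec_eq h h1, mulVec_zero]
  ext (_ | k)
  · have h3 := sum_liftVec hU h x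
    have hc : (U.card : ℝ) ≠ 0 := by exact_mod_cast (Finset.card_pos.2 hU).ne'
    simpa [h2, hc] using h3
  · rw [← liftVec_notMem (𝒢 := 𝒢) β x k, h2]; rfl

lemma liftVec_reduced_green (hU : U.Nonempty) (hind : 𝒢.Indistinguishable U) {β : V → ℝ}
    (h : (𝒢.schrodinger β).PosDef) (i₀ : {k // k ∉ U}) :
    𝒢.liftVec U β (fun k => (𝒢.reduced U).green (𝒢.reducedPotential U β) k (some i₀)) =
      fun k => 𝒢.green β k i₀ := by
  have hcol : (𝒢.reduced U).schrodinger (𝒢.reducedPotential U β) *ᵥ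
      (fun k => (𝒢.reduced U).green (𝒢.reducedPotential U β) k (some i₀)) =
      Pi.single (some i₀) 1 := by
    have : (fun k => (𝒢.reduced U).green (𝒢.reducedPotential U β) k (some i₀)) =
        (𝒢.reduced U).green (𝒢.reducedPotential U β) *ᵥ Pi.single (some i₀) 1 := by
      rw [mulVec_single_one]; rfl
    rw [this, green, mulVec_mulVec, mul_nonsing_inv _
      ((isUnit_iff_isUnit_det _).1 (isUnit_reduced_schrodinger hU hind h)), one_mulVec]
  have h1 : 𝒢.schrodinger β *ᵥ 𝒢.liftVec U β
      (fun k => (𝒢.reduced U).green (𝒢.reducedPotential U β) k (some i₀)) =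
      Pi.single (i₀ : V) 1 := by
    ext k
    rw [schrodinger_mulVec_liftVec hU hind h, hcol]
    by_cases hk : k ∈ U
    · have : k ≠ i₀ := fun h => i₀.2 (h ▸ hk)
      simp [hk, this]
    · rw [dif_neg hk]
      by_cases hk' : k = i₀
      · subst hk'; simp
      · have : (some ⟨k, hk⟩ : ReducedVertex U) ≠ some i₀ := fun h =>
          hk' (congrArg Subtype.val (Option.some.inj h))
        simp [hk', this]
  rw [← green_mulVec_eq h h1, mulVec_single_one]
  rfl

lemma reduced_green_some (hU : U.Nonempty) (hind : 𝒢.Indistinguishable U) {β : V → ℝ}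
    (h : (𝒢.schrodinger β).PosDef) (i₀ k : {k // k ∉ U}) :
    (𝒢.reduced U).green (𝒢.reducedPotential U β) (some k) (some i₀) = 𝒢.green β k i₀ := by
  have := congrFun (liftVec_reduced_green hU hind h i₀) k
  rwa [liftVec_notMem] at this

/-- Within `U` the column has the profile of the row sums of `(H_{U,U})⁻¹`; the other factor is a
function of `β'`. -/
lemma green_eq_reduced_green_none (hU : U.Nonempty) (hind : 𝒢.Indistinguishable U) {β : V → ℝ}
    (h : (𝒢.schrodinger β).PosDef) (i₀ : {k // k ∉ U}) (k : U) :
    𝒢.green β k i₀ = (U.card : ℝ) / 𝒢.massOn U β *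
      (𝒢.reduced U).green (𝒢.reducedPotential U β) none (some i₀) *
        (𝒢.comap (Subtype.val : U → V)).greenRow (fun y => β y) k := by
  have := congrFun (liftVec_reduced_green hU hind h i₀) k
  rw [liftVec_mem] at this
  exact this.symm

lemma sum_green_eq (hU : U.Nonempty) (hind : 𝒢.Indistinguishable U) {β : V → ℝ}
    (h : (𝒢.schrodinger β).PosDef) (i₀ : {k // k ∉ U}) :
    ∑ k : U, 𝒢.green β k i₀ =
      U.card * (𝒢.reduced U).green (𝒢.reducedPotential U β) none (some i₀) := by
  rw [← sum_liftVec hU h (fun k => (𝒢.reduced U).green (𝒢.reducedPotential U β) k (some i₀)),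
    liftVec_reduced_green hU hind h]

lemma reduced_pinGamma (hU : U.Nonempty) (hind : 𝒢.Indistinguishable U) {β : V → ℝ}
    (h : (𝒢.schrodinger β).PosDef) (i₀ : {k // k ∉ U}) :
    (𝒢.reduced U).pinGamma (𝒢.reducedPotential U β) (some i₀) = 𝒢.pinGamma β i₀ := by
  rw [pinGamma, pinGamma, reduced_green_some hU hind h]

omit [Fintype V] in
/-- For an indistinguishable set, the Schur complement depends on the potential on the set only
through the sum of the entries of the Green matrix. -/
lemma schur_eq (hind : 𝒢.Indistinguishable U) {u : V} (hu : u ∈ U) (a : U → ℝ)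
    (b : {x // x ∉ U} → ℝ) :
    𝒢.schur U a b = Matrix.of fun k l =>
      (𝒢.comap (Subtype.val : {x // x ∉ U} → V)).schrodinger b k l -
        𝒢.weight k u * (𝒢.comap (Subtype.val : U → V)).greenMass a * 𝒢.weight l u := by
  have hB : ∀ (i : U) (l : {x // x ∉ U}), 𝒢.offBlock U i l = -𝒢.weight l u := fun i l => by
    rw [offBlock, 𝒢.symm, hind i i.2 u hu l l.2]
  ext k l
  simp only [schur, Matrix.sub_apply, Matrix.mul_apply, conjTranspose_apply, hB, star_trivial,
    of_apply, greenMass, greenRow, mulVec, dotProduct, mul_one, Finset.mul_sum, Finset.sum_mul]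
  rw [Finset.sum_comm]
  simp

/-- Once the potential outside `U` is fixed, the density and `β'` depend on the potential on `U`
only through its Green mass, so the claim reduces to `lintegral_greenRow_eq` on the induced graph.
-/
lemma lintegral_greenRow_reduced (hind : 𝒢.Indistinguishable U) (k l : U)
    {Ψ : (ReducedVertex U → ℝ) → ENNReal} (hΨ : Measurable Ψ) :
    ∫⁻ β, ENNReal.ofReal ((𝒢.comap (Subtype.val : U → V)).greenRow (fun y => β y) k) *
        Ψ (𝒢.reducedPotential U β) ∂𝒢.potentialLaw =
      ∫⁻ β, ENNReal.ofReal ((𝒢.comap (Subtype.val : U → V)).greenRow (fun y => β y) l) *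
        Ψ (𝒢.reducedPotential U β) ∂𝒢.potentialLaw := by
  set S : ({x // x ∉ U} → ℝ) → ℝ → Matrix {x // x ∉ U} {x // x ∉ U} ℝ := fun b g =>
    Matrix.of fun i j => (𝒢.comap (Subtype.val : {x // x ∉ U} → V)).schrodinger b i j -
      𝒢.weight i k * g * 𝒢.weight j k with hS
  have hmeas : ∀ j : U, Measurable fun β : V → ℝ =>
      ENNReal.ofReal ((𝒢.comap (Subtype.val : U → V)).greenRow (fun y => β y) j) *
        Ψ (𝒢.reducedPotential U β) := fun j =>
    ((measurable_greenRow _ j).comp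
      (measurable_pi_lambda _ fun _ => measurable_pi_apply _)).ennreal_ofReal.mul
        (hΨ.comp (𝒢.measurable_reducedPotential U))
  rw [lintegral_potentialLaw_glue_swap 𝒢 U _ (hmeas k),
    lintegral_potentialLaw_glue_swap 𝒢 U _ (hmeas l)]
  refine lintegral_congr fun b => ?_
  have hΦ : Measurable fun g : ℝ =>
      ENNReal.ofReal (𝒢.schurDensity U (S b g) b) * Ψ (reducedOf U b g) := by
    refine (𝒢.measurable_schurDensity U (fun i j => ?_) measurable_const).ennreal_ofReal.mul
      (hΨ.comp ((measurable_reducedOf U).comp measurable_prodMk_left))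
    simp only [hS, of_apply]
    fun_prop
  have key : ∀ (j : U) (a : U → ℝ), ENNReal.ofReal (𝒢.outerDensity U a b) *
      (ENNReal.ofReal ((𝒢.comap (Subtype.val : U → V)).greenRow
        (fun y => glue U a b y) j) * Ψ (𝒢.reducedPotential U (glue U a b))) =
      ENNReal.ofReal ((𝒢.comap (Subtype.val : U → V)).greenRow a j) *
        (ENNReal.ofReal (𝒢.schurDensity U
          (S b ((𝒢.comap (Subtype.val : U → V)).greenMass a)) b) *
          Ψ (reducedOf U b ((𝒢.comap (Subtype.val : U → V)).greenMass a))) := by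
    intro j a
    rw [outerDensity, schur_eq hind k.2, reducedPotential_eq, massOn]
    simp only [glue_mem, glue_notMem]
    rw [mul_left_comm]
  simp only [key]
  exact lintegral_greenRow_eq _ k l hΦ

end Reduced

end H22.WeightedGraph
end

/-! ### The `u`-field: integrability and comparison with the reduced field. -/

noncomputable section

open Matrix

namespace H22.WeightedGraph

section Field

variable {V : Type*} [Fintype V] [DecidableEq V] {𝒢 : WeightedGraph V}

lemma exp_uField (hconn : 𝒢.toSimpleGraph.Connected) {β : V → ℝ}
    (h : (𝒢.schrodinger β).PosDef) (i k : V) :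
    Real.exp (𝒢.uField β i k) = 𝒢.green β k i / 𝒢.green β i i := by
  rw [uField, Real.exp_log (div_pos (green_pos hconn h k i) (green_diag_pos h i))]

lemma measurable_exp_uField (i k : V) : Measurable fun β => Real.exp (𝒢.uField β i k) :=
  ((𝒢.measurable_green_apply measurable_id k i).div
    (𝒢.measurable_green_apply measurable_id i i)).log.exp

/-- For `k ≠ i`, `e^{u_k}` is an entry of the Green matrix off `i` applied to `link`. The density of
the potential off `i` contributes exactly the tilt at `η = link` in `lintegral_green_mulVec_le`. -/
lemma integrable_exp_uField (hconn : 𝒢.toSimpleGraph.Connected) (i k : V) :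
    Integrable (fun β => Real.exp (𝒢.uField β i k)) 𝒢.potentialLaw := by
  by_cases hk : k = i
  · subst hk
    refine (integrable_const (1 : ℝ)).congr ?_
    filter_upwards [𝒢.ae_posDef] with β hβ
    rw [exp_uField hconn hβ, div_self (green_diag_pos hβ k).ne']
  have hki : k ∈ ({i}ᶜ : Finset V) := by simpa using hk
  set κ : ({i}ᶜ : Finset V) := ⟨k, hki⟩
  have hF : Measurable fun z : (({i}ᶜ : Finset V) → ℝ) × ℝ =>
      ENNReal.ofReal (((𝒢.erase i).green z.1 *ᵥ 𝒢.link i) κ) :=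
    ((𝒢.erase i).measurable_green_mulVec measurable_fst _ κ).ennreal_ofReal
  refine ⟨(measurable_exp_uField i k).aestronglyMeasurable, ?_⟩
  rw [hasFiniteIntegral_iff_ofReal (Filter.Eventually.of_forall fun _ => (Real.exp_pos _).le)]
  have h1 : ∫⁻ β, ENNReal.ofReal (Real.exp (𝒢.uField β i k)) ∂𝒢.potentialLaw =
      ∫⁻ β, ENNReal.ofReal (((𝒢.erase i).green (off i β) *ᵥ 𝒢.link i) κ) ∂𝒢.potentialLaw := by
    refine lintegral_congr_ae ?_
    filter_upwards [𝒢.ae_posDef] with β hβ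
    rw [exp_uField hconn hβ, ← 𝒢.green_ratio hβ κ]
  have := isProbabilityMeasure_gammaMeasure (a := 1 / 2) (r := 1) (by norm_num) one_pos
  rw [h1, 𝒢.lintegral_potentialLaw_vertex i _ hF]
  simp only [lintegral_const, measure_univ, mul_one]
  have h2 : ∀ a, ENNReal.ofReal (Real.exp (∑ k, 𝒢.link i k - 𝒢.linkForm i a / 2)) *
      ENNReal.ofReal (((𝒢.erase i).green a *ᵥ 𝒢.link i) κ) =
      ENNReal.ofReal (Real.exp (∑ k, 𝒢.link i k)) *
        ENNReal.ofReal (((𝒢.erase i).green a *ᵥ 𝒢.link i) κ *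
          Real.exp (-(𝒢.link i ⬝ᵥ ((𝒢.erase i).green a *ᵥ 𝒢.link i)) / 2)) := by
    intro a
    rw [← ENNReal.ofReal_mul (Real.exp_pos _).le, ← ENNReal.ofReal_mul (Real.exp_pos _).le,
      sub_eq_add_neg, Real.exp_add, linkForm, neg_div]
    congr 1
    ring
  simp only [h2]
  rw [lintegral_const_mul' _ _ ENNReal.ofReal_ne_top]
  exact ENNReal.mul_lt_top ENNReal.ofReal_lt_top
    (((𝒢.erase i).lintegral_green_mulVec_le fun k => 𝒢.nonneg _ _).trans_lt
      ENNReal.ofReal_lt_top)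

variable {U : Finset V}

lemma exp_uField_reduced_some (hU : U.Nonempty)
    (hind : 𝒢.Indistinguishable U) {β : V → ℝ} (h : (𝒢.schrodinger β).PosDef)
    (i₀ k : {k // k ∉ U}) :
    Real.exp ((𝒢.reduced U).uField (𝒢.reducedPotential U β) (some i₀) (some k)) =
      Real.exp (𝒢.uField β i₀ k) := by
  rw [uField, uField, reduced_green_some hU hind h, reduced_green_some hU hind h]

lemma reduced_green_none_pos (hconn : 𝒢.toSimpleGraph.Connected) (hU : U.Nonempty)
    (hind : 𝒢.Indistinguishable U) {β : V → ℝ} (h : (𝒢.schrodinger β).PosDef)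
    (i₀ : {k // k ∉ U}) :
    0 < (𝒢.reduced U).green (𝒢.reducedPotential U β) none (some i₀) := by
  have : Nonempty U := hU.to_subtype
  have h1 : 0 < ∑ k : U, 𝒢.green β k i₀ :=
    Finset.sum_pos (fun k _ => green_pos hconn h k i₀) Finset.univ_nonempty
  rw [sum_green_eq hU hind h] at h1
  exact pos_of_mul_pos_right h1 (Nat.cast_nonneg _)

/-- The reduced `u`-field at the merged vertex is an average over the merged set. -/
lemma card_mul_exp_uField_reduced_none (hconn : 𝒢.toSimpleGraph.Connected) (hU : U.Nonempty)
    (hind : 𝒢.Indistinguishable U) {β : V → ℝ} (h : (𝒢.schrodinger β).PosDef)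
    (i₀ : {k // k ∉ U}) :
    U.card * Real.exp ((𝒢.reduced U).uField (𝒢.reducedPotential U β) (some i₀) none) =
      ∑ k : U, Real.exp (𝒢.uField β i₀ k) := by
  simp only [exp_uField hconn h]
  rw [uField, reduced_green_some hU hind h, Real.exp_log (div_pos
    (reduced_green_none_pos hconn hU hind h i₀) (green_diag_pos h _)), ← Finset.sum_div,
    sum_green_eq hU hind h, mul_div_assoc]

lemma exp_uField_reduced_eq_pinnedColumn (hconn : 𝒢.toSimpleGraph.Connected) (hU : U.Nonempty)
    (hind : 𝒢.Indistinguishable U) {β : V → ℝ} (h : (𝒢.schrodinger β).PosDef)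
    (i₀ : {k // k ∉ U}) (k : ReducedVertex U) :
    Real.exp ((𝒢.reduced U).uField (𝒢.reducedPotential U β) (some i₀) k) =
      (𝒢.reduced U).pinnedColumn (𝒢.reducedPotential U β) (some i₀) k := by
  have hi : 0 < (𝒢.reduced U).green (𝒢.reducedPotential U β) (some i₀) (some i₀) := by
    rw [reduced_green_some hU hind h]; exact green_diag_pos h _
  have hk : 0 < (𝒢.reduced U).green (𝒢.reducedPotential U β) k (some i₀) := by
    rcases k with _ | k
    · exact reduced_green_none_pos hconn hU hind h i₀
    · rw [reduced_green_some hU hind h]; exact green_pos hconn h _ _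
  rw [pinnedColumn_eq _ (isUnit_reduced_schrodinger hU hind h) hi.ne', uField,
    Real.exp_log (div_pos hk hi)]

lemma lintegral_exp_uField_reduced (hconn : 𝒢.toSimpleGraph.Connected) (hU : U.Nonempty)
    (hind : 𝒢.Indistinguishable U) (i₀ : {k // k ∉ U}) (k l : U)
    {Ψ : (ReducedVertex U → ℝ) → ENNReal} (hΨ : Measurable Ψ) :
    ∫⁻ β, ENNReal.ofReal (Real.exp (𝒢.uField β i₀ k)) * Ψ (𝒢.reducedPotential U β)
        ∂𝒢.potentialLaw =
      ∫⁻ β, ENNReal.ofReal (Real.exp (𝒢.uField β i₀ l)) * Ψ (𝒢.reducedPotential U β)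
        ∂𝒢.potentialLaw := by
  -- The common factor as a function of `β'`: `2 β'_u / |U|` equals `|U| / massOn`.
  set θ : (ReducedVertex U → ℝ) → ℝ := fun b => 2 * b none / U.card *
    (𝒢.reduced U).green b none (some i₀) / (𝒢.reduced U).green b (some i₀) (some i₀) with hθ
  have hθm : Measurable θ :=
    (((((measurable_pi_apply none).const_mul 2).div_const _).mul
      ((𝒢.reduced U).measurable_green_apply measurable_id _ _)).div
        ((𝒢.reduced U).measurable_green_apply measurable_id _ _))
  have hc : (U.card : ℝ) ≠ 0 := by exact_mod_cast (Finset.card_pos.2 hU).ne'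
  have key : ∀ j : U,
      ∫⁻ β, ENNReal.ofReal (Real.exp (𝒢.uField β i₀ j)) * Ψ (𝒢.reducedPotential U β)
        ∂𝒢.potentialLaw =
      ∫⁻ β, ENNReal.ofReal ((𝒢.comap (Subtype.val : U → V)).greenRow (fun y => β y) j) *
        (ENNReal.ofReal (θ (𝒢.reducedPotential U β)) * Ψ (𝒢.reducedPotential U β))
        ∂𝒢.potentialLaw := by
    intro j
    refine lintegral_congr_ae ?_
    filter_upwards [𝒢.ae_posDef] with β hβ
    have hpd := 𝒢.posDef_comap (f := (Subtype.val : U → V)) Subtype.val_injective hβ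
    have hm := (massOn_pos hU hβ).ne'
    rw [← mul_assoc, ← ENNReal.ofReal_mul (greenRow_nonneg hpd j), exp_uField hconn hβ,
      green_eq_reduced_green_none hU hind hβ, ← reduced_green_some hU hind hβ i₀ i₀]
    congr 2
    have hnone : 𝒢.reducedPotential U β none =
        1 / (2 * (1 / (U.card : ℝ) ^ 2 * 𝒢.massOn U β)) := by
      rw [reducedPotential_eq]; rfl
    simp only [hθ, hnone]
    field_simp
  rw [key k, key l]
  exact lintegral_greenRow_reduced hind k l (hθm.ennreal_ofReal.mul hΨ)

end Field

/-! ### Integrals over the sets of `𝓕'` and conditional expectations. -/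

section Conditional

variable {V : Type*} [Fintype V] [DecidableEq V] {𝒢 : WeightedGraph V} {U : Finset V}
  {Ω : Type*} {mΩ : MeasurableSpace Ω} {β : Ω → V → ℝ} {P : Measure Ω}

lemma reducedSigma_le (hβ : Measurable β) (i₀ : {k // k ∉ U}) :
    𝒢.reducedSigma U β i₀ ≤ mΩ :=
  sup_le (iSup_le fun _ => (((measurable_pi_apply _).comp
    (𝒢.measurable_reducedPotential U)).comp hβ).comap_le) (𝒢.measurable_pinGamma hβ _).comap_le

/-- Up to the value at the pinning vertex, which is replaced by `γ`, the reduced potential generates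
the `σ`-algebra `𝓕'`. -/
lemma exists_of_measurableSet_reducedSigma (i₀ : {k // k ∉ U}) {s : Set Ω}
    (hs : MeasurableSet[𝒢.reducedSigma U β i₀] s) :
    ∃ T : Set (({k : ReducedVertex U // k ≠ some i₀} → ℝ) × ℝ), MeasurableSet T ∧
      s = (fun ω => (fun k : {k : ReducedVertex U // k ≠ some i₀} =>
        𝒢.reducedPotential U (β ω) k, 𝒢.pinGamma (β ω) i₀)) ⁻¹' T := by
  set Z : Ω → ({k : ReducedVertex U // k ≠ some i₀} → ℝ) × ℝ := fun ω =>
    (fun k : {k : ReducedVertex U // k ≠ some i₀} =>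
      𝒢.reducedPotential U (β ω) k, 𝒢.pinGamma (β ω) i₀) with hZ
  have hle : 𝒢.reducedSigma U β i₀ ≤ MeasurableSpace.comap Z inferInstance := by
    have hZm : Measurable[MeasurableSpace.comap Z inferInstance] Z := comap_measurable Z
    refine sup_le (iSup_le fun k => Measurable.comap_le ?_) (Measurable.comap_le ?_)
    · exact (measurable_pi_apply k).comp (measurable_fst.comp hZm)
    · exact measurable_snd.comp hZm
  obtain ⟨T, hT, rfl⟩ := hle s hs
  exact ⟨T, hT, rfl⟩

/-- The ratio of entries of `G'` formally involves `β'` at `i₀`; `pinnedColumn` is a version that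
does not. -/
lemma aestronglyMeasurable_exp_uField_reduced (hconn : 𝒢.toSimpleGraph.Connected)
    (hU : U.Nonempty) (hind : 𝒢.Indistinguishable U) (i₀ : {k // k ∉ U})
    (hpd : ∀ᵐ ω ∂P, (𝒢.schrodinger (β ω)).PosDef) (k : ReducedVertex U) :
    AEStronglyMeasurable[𝒢.reducedSigma U β i₀] (fun ω => Real.exp
      ((𝒢.reduced U).uField (𝒢.reducedPotential U (β ω)) (some i₀) k)) P := by
  have hm : Measurable[𝒢.reducedSigma U β i₀] fun ω =>
      (𝒢.reduced U).pinnedColumn (𝒢.reducedPotential U (β ω)) (some i₀) k := by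
    refine @measurable_pinnedColumn _ _ _ (𝒢.reduced U) Ω (𝒢.reducedSigma U β i₀) _ _
      (fun j hj => ?_) k
    refine Measurable.of_comap_le (le_sup_of_le_left ?_)
    exact le_iSup (fun j : {k : ReducedVertex U // k ≠ some i₀} =>
      MeasurableSpace.comap (fun ω => 𝒢.reducedPotential U (β ω) j) inferInstance) ⟨j, hj⟩
  refine ⟨_, hm.stronglyMeasurable, ?_⟩
  filter_upwards [hpd] with ω hω
  exact exp_uField_reduced_eq_pinnedColumn hconn hU hind hω i₀ k

lemma setIntegral_exp_uField_eq (hconn : 𝒢.toSimpleGraph.Connected) (hU : U.Nonempty)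
    (hind : 𝒢.Indistinguishable U) (i₀ : {k // k ∉ U}) (hβ : Measurable β)
    (hlaw : P.map β = 𝒢.potentialLaw) (k l : U) {s : Set Ω}
    (hs : MeasurableSet[𝒢.reducedSigma U β i₀] s) :
    ∫ ω in s, Real.exp (𝒢.uField (β ω) i₀ k) ∂P = ∫ ω in s, Real.exp (𝒢.uField (β ω) i₀ l) ∂P := by
  have hpd : ∀ᵐ ω ∂P, (𝒢.schrodinger (β ω)).PosDef :=
    ae_of_ae_map hβ.aemeasurable (hlaw ▸ 𝒢.ae_posDef)
  have hs' : MeasurableSet s := reducedSigma_le hβ i₀ s hs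
  obtain ⟨T, hT, rfl⟩ := exists_of_measurableSet_reducedSigma i₀ hs
  -- Almost surely `γ` is the pinning variable of the reduced graph, hence a function of `β'`; so a
  -- set of `𝓕'` is, up to a null set, an event on `β'` alone.
  set Φ : (ReducedVertex U → ℝ) → ({k : ReducedVertex U // k ≠ some i₀} → ℝ) × ℝ := fun b =>
    (fun k => b k, (𝒢.reduced U).pinGamma b (some i₀)) with hΦ
  have hΦm : Measurable Φ := (measurable_pi_lambda _ fun _ => measurable_pi_apply _).prodMk
    ((𝒢.reduced U).measurable_pinGamma measurable_id _)
  set Ψ : (ReducedVertex U → ℝ) → ENNReal := (Φ ⁻¹' T).indicator 1 with hΨ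
  have hΨm : Measurable Ψ := measurable_one.indicator (hT.preimage hΦm)
  have hmF : ∀ j : U, Measurable fun β => ENNReal.ofReal (Real.exp (𝒢.uField β i₀ j)) *
      Ψ (𝒢.reducedPotential U β) := fun j =>
    (measurable_exp_uField _ _).ennreal_ofReal.mul (hΨm.comp (𝒢.measurable_reducedPotential U))
  have key : ∀ j : U, ∫ ω in (fun ω => (fun k : {k : ReducedVertex U // k ≠ some i₀} =>
        𝒢.reducedPotential U (β ω) k, 𝒢.pinGamma (β ω) i₀)) ⁻¹' T,
        Real.exp (𝒢.uField (β ω) i₀ j) ∂P =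
      (∫⁻ β, ENNReal.ofReal (Real.exp (𝒢.uField β i₀ j)) * Ψ (𝒢.reducedPotential U β)
        ∂𝒢.potentialLaw).toReal := by
    intro j
    rw [integral_eq_lintegral_of_nonneg_ae (Filter.Eventually.of_forall fun _ => (Real.exp_pos _).le)
      ((measurable_exp_uField _ _).comp hβ).aestronglyMeasurable, ← hlaw,
      lintegral_map (hmF j) hβ, ← lintegral_indicator hs']
    congr 1
    refine lintegral_congr_ae ?_
    filter_upwards [hpd] with ω hω
    have hγ := reduced_pinGamma hU hind hω i₀
    by_cases hmem : Φ (𝒢.reducedPotential U (β ω)) ∈ T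
    · have h1 : Ψ (𝒢.reducedPotential U (β ω)) = 1 := Set.indicator_of_mem (s := Φ ⁻¹' T) hmem _
      rw [h1, mul_one]
      refine Set.indicator_of_mem ?_ _
      simpa only [hΦ, hγ, Set.mem_preimage] using hmem
    · have h1 : Ψ (𝒢.reducedPotential U (β ω)) = 0 := Set.indicator_of_notMem (s := Φ ⁻¹' T) hmem _
      rw [h1, mul_zero]
      refine Set.indicator_of_notMem ?_ _
      simpa only [hΦ, hγ, Set.mem_preimage] using hmem
  rw [key k, key l, lintegral_exp_uField_reduced hconn hU hind i₀ k l hΨm]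

/-- The reduced field at `u` is the average of `e^{u_j}` over `U`, and all these terms have the same
integral over `s`. -/
lemma setIntegral_exp_uField_reduced_none (hconn : 𝒢.toSimpleGraph.Connected) (hU : U.Nonempty)
    (hind : 𝒢.Indistinguishable U) (i₀ : {k // k ∉ U}) (hβ : Measurable β)
    (hlaw : P.map β = 𝒢.potentialLaw)
    (hint : ∀ k, Integrable (fun ω => Real.exp (𝒢.uField (β ω) i₀ k)) P) (k : U) {s : Set Ω}
    (hs : MeasurableSet[𝒢.reducedSigma U β i₀] s) :
    ∫ ω in s, Real.exp ((𝒢.reduced U).uField (𝒢.reducedPotential U (β ω)) (some i₀) none) ∂P =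
      ∫ ω in s, Real.exp (𝒢.uField (β ω) i₀ k) ∂P := by
  have hpd : ∀ᵐ ω ∂P, (𝒢.schrodinger (β ω)).PosDef :=
    ae_of_ae_map hβ.aemeasurable (hlaw ▸ 𝒢.ae_posDef)
  have hc : (U.card : ℝ) ≠ 0 := by exact_mod_cast (Finset.card_pos.2 hU).ne'
  refine mul_left_cancel₀ hc ?_
  rw [← integral_const_mul]
  have h1 : ∀ᵐ ω ∂P.restrict s, U.card *
      Real.exp ((𝒢.reduced U).uField (𝒢.reducedPotential U (β ω)) (some i₀) none) =
      ∑ j : U, Real.exp (𝒢.uField (β ω) i₀ j) :=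
    ae_restrict_of_ae (hpd.mono fun ω hω => card_mul_exp_uField_reduced_none hconn hU hind hω i₀)
  have h2 : ∫ ω in s, ∑ j : U, Real.exp (𝒢.uField (β ω) i₀ j) ∂P =
      ∑ j : U, ∫ ω in s, Real.exp (𝒢.uField (β ω) i₀ j) ∂P :=
    integral_finsetSum Finset.univ fun j _ => (hint j).integrableOn
  rw [integral_congr_ae h1, h2,
    Finset.sum_congr rfl fun j _ => setIntegral_exp_uField_eq hconn hU hind i₀ hβ hlaw j k hs]
  simp

end Conditional

end H22.WeightedGraph
end

theorem mainTheorem6 {V : Type*} [Fintype V] [DecidableEq V]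
    (𝒢 : H22.WeightedGraph V) (hconn : 𝒢.toSimpleGraph.Connected)
    (U : Finset V) (hU : U.Nonempty) (hind : 𝒢.Indistinguishable U)
    (i₀ : {k : V // k ∉ U})
    {Ω : Type*} [mΩ : MeasurableSpace Ω] (P : Measure Ω) [IsProbabilityMeasure P]
    (β : Ω → V → ℝ) (hβ : Measurable β) (hlaw : P.map β = 𝒢.potentialLaw) :
    P.map (fun ω => 𝒢.pinGamma (β ω) i₀) = gammaMeasure (1 / 2) 1 ∧
    (∀ k : V, Integrable (fun ω => Real.exp (𝒢.uField (β ω) i₀ k)) P) ∧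
    (∀ k : {k : V // k ∉ U},
      P[fun ω => Real.exp (𝒢.uField (β ω) i₀ k) | 𝒢.reducedSigma U β i₀] =ᵐ[P]
        fun ω => Real.exp
          ((𝒢.reduced U).uField (𝒢.reducedPotential U (β ω)) (some i₀) (some k))) ∧
    (∀ k ∈ U,
      P[fun ω => Real.exp (𝒢.uField (β ω) i₀ k) | 𝒢.reducedSigma U β i₀] =ᵐ[P]
        fun ω => Real.exp
          ((𝒢.reduced U).uField (𝒢.reducedPotential U (β ω)) (some i₀) none)) := by
  have hpd : ∀ᵐ ω ∂P, (𝒢.schrodinger (β ω)).PosDef :=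
    ae_of_ae_map hβ.aemeasurable (hlaw ▸ 𝒢.ae_posDef)
  have hint : ∀ k : V, Integrable (fun ω => Real.exp (𝒢.uField (β ω) i₀ k)) P := fun k => by
    have h := H22.WeightedGraph.integrable_exp_uField hconn i₀ k
    rw [← hlaw] at h
    exact h.comp_measurable hβ
  have hm := H22.WeightedGraph.reducedSigma_le (𝒢 := 𝒢) hβ i₀
  refine ⟨?_, hint, fun k => ?_, fun k hk => ?_⟩
  · have hγ : Measurable fun β => 𝒢.pinGamma β i₀ := 𝒢.measurable_pinGamma measurable_id _
    rw [← 𝒢.map_pinGamma_potentialLaw i₀, ← hlaw, Measure.map_map hγ hβ]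
    rfl
  -- Outside `U` the two fields agree almost surely, so measurability with respect to `𝓕'` alone
  -- determines the conditional expectation.
  · have heq : (fun ω => Real.exp (𝒢.uField (β ω) i₀ k)) =ᵐ[P] fun ω => Real.exp
        ((𝒢.reduced U).uField (𝒢.reducedPotential U (β ω)) (some i₀) (some k)) :=
      hpd.mono fun ω hω =>
        (H22.WeightedGraph.exp_uField_reduced_some hU hind hω i₀ k).symm
    refine (condExp_of_aestronglyMeasurable' hm ?_ (hint k)).trans heq
    exact (H22.WeightedGraph.aestronglyMeasurable_exp_uField_reduced hconn hU hind i₀ hpd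
      (some k)).congr heq.symm
  · have hset := fun j : U => fun (s : Set Ω) hs =>
      H22.WeightedGraph.setIntegral_exp_uField_reduced_none hconn hU hind i₀ hβ hlaw hint j
        (s := s) hs
    have hnone : Integrable (fun ω => Real.exp
        ((𝒢.reduced U).uField (𝒢.reducedPotential U (β ω)) (some i₀) none)) P := by
      have hc : (U.card : ℝ) ≠ 0 := by exact_mod_cast (Finset.card_pos.2 hU).ne'
      have hsum : Integrable (fun ω => ∑ j : U, Real.exp (𝒢.uField (β ω) i₀ j)) P :=
        integrable_finsetSum Finset.univ fun (j : U) _ => hint j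
      refine (hsum.const_mul (U.card : ℝ)⁻¹).congr (hpd.mono fun ω hω => ?_)
      simp only
      rw [← H22.WeightedGraph.card_mul_exp_uField_reduced_none hconn hU hind hω i₀,
        inv_mul_cancel_left₀ hc]
    exact (ae_eq_condExp_of_forall_setIntegral_eq hm (hint k) (fun s _ _ => hnone.integrableOn)
      (fun s hs _ => hset ⟨k, hk⟩ s hs)
      (H22.WeightedGraph.aestronglyMeasurable_exp_uField_reduced hconn hU hind i₀ hpd
        none)).symm
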